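/- Let $k$ be a field that is complete with respect to a (possibly trivial) multiplicative non-Archimedean valuation $|\cdot|\colon k\to\mathbb R_{\ge 0}$, and let $V$ be a Banach $k$-vector space, i.e. a $k$-vector space, complete for a norm with $\|v-w\|\le\max\{\|v\|,\|w\|\}$ and $\|cv\|=|c|\,\|v\|$. Closed subspaces of $V$ carry the restricted norm. For $S\subseteq V$ let $\langle S\rangle$ be the closure of the $k$-linear span of $S$, let $\operatorname{rank}(V)$ be the least cardinality of an $S\subseteq V$ with $\langle S\rangle=V$, and for a cardinal $\mu$ let $\mathcal L_{<\mu}(V)=\{\langle S\rangle : S\subseteq V,\ \#S<\mu\}$. A Banach $k$-vector space $X$ is *free* if it has an orthonormal Schauder basis: a set $E\subseteq X$ with $\|e\|=1$ for all $e\in E$, such that $\|\sum_{e\in E}c(e)e\|=\sup_{e\in E}|c(e)|$ for every $c\colon E\to k$ for which $\{e\in E:|c(e)|\ge\epsilon\}$ is finite for all $\epsilon>0$, and such that every $v\in X$ is of the form $\sum_{e\in E}c(e)e$ for such a $c$. Put $\kappa=\operatorname{rank}(V)$. $V$ is *almost free* if every member of $\mathcal L_{<\kappa}(V)$ is free. A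 *free filtration* of $V$ is a family $\mathcal V=(\mathcal V(\alpha))_{\alpha<\kappa}$ of free members of $\mathcal L_{<\kappa}(V)$ such that $\mathcal V(\beta)\subseteq\mathcal V(\alpha)$ for $\beta<\alpha<\kappa$, $\mathcal V(\alpha)=\langle\bigcup_{\beta<\alpha}\mathcal V(\beta)\rangle$ for every non-zero limit ordinal $\alpha<\kappa$, and $V=\bigcup_{\alpha<\kappa}\mathcal V(\alpha)$. A closed subspace $W$ of a Banach $k$-vector space $X$ is a *cofree direct summand* of $X$ if there is a free closed subspace $W^\perp\subseteq X$ such that the addition map $W\oplus W^\perp\to X$ is an isometric isomorphism, where $\|(w,w')\|=\max\{\|w\|,\|w'\|\}$. A closed subspace $W$ of $V$ is an *almost cofree direct summand* of $V$ if $W$ is a cofree direct summand of every $W'\in\mathcal L_{<\kappa}(V)$ with $W\subseteq W'$. The *exceptional set* of a free filtration $\mathcal V$ of $V$ is $$E_{\mathcal V}=\{\alpha<\kappa : \mathcal V(\alpha)\text{ is not an almost cofree direct summand of }V\}.$$ **Lemma.** Suppose that $\#V=\operatorname{rank}(V)=\kappa$ and that $\kappa$ is an uncountable regular cardinal. Then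 the following are equivalent: 1. $V$ is free. 2. There is a free filtration $\mathcal V$ of $V$ such that $E_{\mathcal V}$ is not stationary in $\kappa$. 3. $V$ is almost free, and for every free filtration $\mathcal V$ of $V$, $E_{\mathcal V}$ is not stationary in $\kappa$. -/

import Mathlib

open scoped Cardinal

namespace NonArchBanach

universe u v

section Basic

variable (k : Type u) [NormedField k] {V : Type v} [NormedAddCommGroup V] [NormedSpace k V]

/-- `⟨S⟩`: the closure of the `k`-linear subspace generated by `S`. -/
def closedSpan (S : Set V) : Submodule k V := (Submodule.span k S).topologicalClosure

/-- `E` is an orthonormal Schauder basis of `V`. The elements of `C₀(E, k)` are the functions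
`c : E → k` that tend to `0` along the cofinite filter, with the supremum norm. -/
structure IsOrthonormalSchauderBasis (E : Set V) : Prop where
  norm_eq_one : ∀ e ∈ E, ‖e‖ = 1
  norm_sum : ∀ c : E → k, Filter.Tendsto c Filter.cofinite (nhds 0) →
    ∃ s : V, HasSum (fun e : E => c e • (e : V)) s ∧ ‖s‖ = ⨆ e : E, ‖c e‖
  expansion : ∀ v : V, ∃ c : E → k, Filter.Tendsto c Filter.cofinite (nhds 0) ∧
    HasSum (fun e : E => c e • (e : V)) v

variable (V)

/-- The least cardinality of a subset `S` of `V` with `⟨S⟩ = V`. -/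
noncomputable def rank : Cardinal.{v} :=
  sInf {c : Cardinal.{v} | ∃ S : Set V, #S = c ∧ closedSpan k S = ⊤}

/-- `V` is free: it admits an orthonormal Schauder basis. -/
def IsFree : Prop := ∃ E : Set V, IsOrthonormalSchauderBasis k E

/-- `𝓛_{<κ}(V)`: the set of closed subspaces `⟨S⟩` with `#S < κ`. -/
def smallSubspaces (κ : Cardinal.{v}) : Set (Submodule k V) :=
  {W | ∃ S : Set V, #S < κ ∧ closedSpan k S = W}

/-- `V` is `κ`-free: every member of `𝓛_{<κ}(V)` is free, as a normed space of its own. -/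
def IsCardinalFree (κ : Cardinal.{v}) : Prop := ∀ W ∈ smallSubspaces k V κ, IsFree k W

/-- `V` is almost free: it is `rank V`-free. -/
def IsAlmostFree : Prop := IsCardinalFree k V (rank k V)

/-- A family of subspaces of `V` indexed by the ordinals below the initial ordinal of `rank V` is a
free filtration of `V`. -/
structure IsFreeFiltration (F : Set.Iio (rank k V).ord → Submodule k V) : Prop where
  mem_smallSubspaces : ∀ α, F α ∈ smallSubspaces k V (rank k V)
  free : ∀ α, IsFree k (F α)
  mono : ∀ α β, β < α → F β ≤ F α
  limit : ∀ α : Set.Iio (rank k V).ord, Order.IsSuccLimit (α : Ordinal.{v}) →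
    F α = closedSpan k (⋃ β : Set.Iio α, (F (β : Set.Iio (rank k V).ord) : Set V))
  exhaust : ⋃ α, (F α : Set V) = Set.univ

end Basic

section Cofree

variable {k : Type u} [NormedField k] {V : Type v} [NormedAddCommGroup V] [NormedSpace k V]

/-- `W'` is a free supplement of `W` in `V`: a free closed subspace such that the addition map
`W ⊕ W' → V` is an isometric isomorphism, where `W ⊕ W'` carries the maximum norm (which is the norm
of the product type in Mathlib). -/
structure IsFreeSupplement (W W' : Submodule k V) : Prop where
  isClosed : IsClosed (W' : Set V)
  free : IsFree k W'
  bijective : Function.Bijective (fun x : W × W' => (x.1 : V) + (x.2 : V))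
  norm_add : ∀ x : W × W', ‖(x.1 : V) + (x.2 : V)‖ = ‖x‖

/-- `W` is a cofree direct summand of `V`. -/
def IsCofreeSummand (W : Submodule k V) : Prop := ∃ W' : Submodule k V, IsFreeSupplement W W'

/-- `W` is an almost cofree direct summand of `V`: it is a cofree direct summand of every member of
`𝓛_{< rank V}(V)` containing it. Here `W.submoduleOf U` is `W` as a subspace of `U`. -/
def IsAlmostCofreeSummand (W : Submodule k V) : Prop :=
  ∀ U ∈ smallSubspaces k V (rank k V), W ≤ U → IsCofreeSummand (W.submoduleOf U)

/-- The exceptional set of a filtration: the stages that are not almost cofree direct summands. -/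
def exceptionalSet (F : Set.Iio (rank k V).ord → Submodule k V) : Set (Set.Iio (rank k V).ord) :=
  {α | ¬ IsAlmostCofreeSummand (F α)}

end Cofree

end NonArchBanach

/-!
The equivalence is a form, for Banach spaces over a non-Archimedean field `k`, of the description of
free groups of regular uncountable cardinality by filtrations. Its analytic core is Gruson's theorem
that closed subspaces of free spaces are free (`IsFree.of_linearIsometry`).

*Freeness.* An orthonormal set `B` (`IsOrthonormalSet`) defines an isometry of `C₀(B, k)` onto the
closed span of `B`. Hence a complete space is free if and only if it is the closed span of an
orthonormal set, and free spaces are, up to isometry, the spaces `C₀(ι, k)` with `ι` discrete.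

*Gruson's theorem.* Let `W` be a subspace of `C₀(ι, k)`. By Zorn's lemma there is a maximal pair of
a set `A ⊆ ι` and an orthonormal basis of the part of `W` supported on `A`, where `A` is restricted
to sets within which `W` is approximated (`IsApproximatedWithin`): a function supported on `A` that
is within distance `1 / (n + 1)` of `W` is so by virtue of an element of `W` supported on `A`. This
condition passes to unions of chains. It also allows `A` to be enlarged by countably many indices:
the functions supported on a fixed finite set and within distance `1 / (n + 1)` of `W` form a module
over the unit ball of `k`, and such modules are countably generated because every set of real
numbers has a countable cofinal subset (`exists_countable_generators`). Therefore there is a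
countable set closed under the supports of the relevant elements of `W`
(`exists_countable_approximation`), and countably many vectors of `C₀(ι, k)` can be orthonormalized,
since norms are attained at coordinates. The argument makes no distinction between trivial, discrete
and dense valuations.

*The equivalence.* If `V` is free, it is almost free by Gruson's theorem. By regularity of `κ`, any
free filtration of `V` agrees on a club set with the filtration spanned by the initial segments of a
basis (`isClub_setOf_eq`). In a closed subspace `U` containing it, a stage of the latter has as
complement the intersection of `U` with the span of the rest of the basis, which is free by Gruson's
theorem. If `V` is almost free, an enumeration of its elements gives a free filtration. Finally, if
all stages of a free filtration in a club set `C` are almost cofree summands, each has a free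
complement in the stage at the next element of `C`, and the bases of these complements, together
with a basis of the stage at the second element of `C` in place of the first complement, form an
orthonormal basis of `V` (`isOrthonormalSet_iUnion`).
-/

namespace NonArchBanach

universe u v w

open scoped ZeroAtInfty
open Filter Topology

/-! ### Closed spans and orthonormal sets -/

section ClosedSpan

variable {k : Type u} [NormedField k] {V : Type v} [NormedAddCommGroup V] [NormedSpace k V]

theorem isClosed_closedSpan (S : Set V) : IsClosed (closedSpan k S : Set V) :=
  Submodule.isClosed_topologicalClosure _

theorem subset_closedSpan (S : Set V) : S ⊆ closedSpan k S :=
  Submodule.subset_span.trans (Submodule.le_topologicalClosure _)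

theorem closedSpan_le {S : Set V} {W : Submodule k V} (hW : IsClosed (W : Set V))
    (h : S ⊆ W) : closedSpan k S ≤ W :=
  Submodule.topologicalClosure_minimal _ (Submodule.span_le.2 h) hW

theorem closedSpan_mono {S T : Set V} (h : S ⊆ T) : closedSpan k S ≤ closedSpan k T :=
  closedSpan_le (isClosed_closedSpan T) (h.trans (subset_closedSpan T))

theorem mem_closedSpan_iff {S : Set V} {v : V} :
    v ∈ closedSpan k S ↔ ∀ ε > 0, ∃ w ∈ Submodule.span k S, ‖v - w‖ < ε := by
  rw [closedSpan, ← SetLike.mem_coe, Submodule.topologicalClosure_coe, Metric.mem_closure_iff]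
  simp [dist_eq_norm]

end ClosedSpan

theorem tendsto_cofinite_zero_of_finite_support {ι : Type*} {M : Type*} [Zero M]
    [TopologicalSpace M] {f : ι → M} (hf : f.support.Finite) : Tendsto f cofinite (𝓝 0) :=
  tendsto_const_nhds.congr' (hf.subset fun _ he hne => he hne.symm)

section Orthonormal

variable {k : Type u} [NormedField k] {V : Type v} [NormedAddCommGroup V] [NormedSpace k V]

variable (k) in
/-- A set of unit vectors is orthonormal if no coefficient of a finite linear combination of its
elements exceeds the norm of the combination. In an ultrametric space, this says that the norm of a
linear combination is the maximum of the norms of its coefficients. -/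
structure IsOrthonormalSet (B : Set V) : Prop where
  norm_eq_one : ∀ b ∈ B, ‖b‖ = 1
  norm_coeff_le : ∀ s : Finset V, (s : Set V) ⊆ B → ∀ c : V → k, ∀ b ∈ s,
    ‖c b‖ ≤ ‖∑ x ∈ s, c x • x‖

theorem IsOrthonormalSet.mono {B B' : Set V} (h : IsOrthonormalSet k B') (hB : B ⊆ B') :
    IsOrthonormalSet k B :=
  ⟨fun b hb => h.norm_eq_one b (hB hb), fun s hs => h.norm_coeff_le s (hs.trans hB)⟩

theorem isOrthonormalSet_empty : IsOrthonormalSet k (∅ : Set V) :=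
  ⟨by simp, fun s hs c b hb => absurd (hs hb) (by simp)⟩

theorem IsOrthonormalSet.norm_coeff_le_subtype {B : Set V} (h : IsOrthonormalSet k B)
    (s : Finset B) (c : B → k) {b : B} (hb : b ∈ s) : ‖c b‖ ≤ ‖∑ x ∈ s, c x • (x : V)‖ := by
  classical
  have := h.norm_coeff_le (s.map (Function.Embedding.subtype _)) (by simp)
    (fun v => if hv : v ∈ B then c ⟨v, hv⟩ else 0) b (by simp [hb])
  simpa using this

theorem IsOrthonormalSet.image {V' : Type w} [NormedAddCommGroup V'] [NormedSpace k V']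
    {B : Set V} (h : IsOrthonormalSet k B) (φ : V →ₗᵢ[k] V') : IsOrthonormalSet k (φ '' B) := by
  classical
  refine ⟨?_, fun s hs c b hb => ?_⟩
  · rintro _ ⟨b, hb, rfl⟩
    rw [φ.norm_map, h.norm_eq_one b hb]
  · obtain ⟨t, ht, rfl⟩ := Finset.subset_set_image_iff.1 hs
    obtain ⟨a, ha, rfl⟩ := Finset.mem_image.1 hb
    rw [Finset.sum_image φ.injective.injOn]
    have := h.norm_coeff_le t ht (fun v => c (φ v)) a ha
    rwa [← φ.norm_map, map_sum, Finset.sum_congr rfl fun x _ => φ.map_smul (c (φ x)) x] at this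

theorem IsOrthonormalSet.of_image {V' : Type w} [NormedAddCommGroup V'] [NormedSpace k V']
    {B : Set V} (φ : V →ₗᵢ[k] V') (h : IsOrthonormalSet k (φ '' B)) : IsOrthonormalSet k B := by
  classical
  refine ⟨fun b hb => ?_, fun s hs c b hb => ?_⟩
  · rw [← φ.norm_map, h.norm_eq_one _ ⟨b, hb, rfl⟩]
  · have := h.norm_coeff_le (s.image φ) (by simpa using Set.image_mono hs)
      (fun v => c (Function.invFun φ v)) (φ b) (Finset.mem_image_of_mem _ hb)
    rw [Finset.sum_image φ.injective.injOn] at this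
    simp only [Function.leftInverse_invFun φ.injective _] at this
    rwa [← φ.norm_map, map_sum, Finset.sum_congr rfl fun x _ => φ.map_smul (c x) x]

theorem IsOrthonormalSet.discreteTopology {B : Set V} (hB : IsOrthonormalSet k B) :
    DiscreteTopology B := by
  classical
  refine DiscreteTopology.of_forall_le_dist one_pos fun x y hxy => ?_
  have := hB.norm_coeff_le_subtype {x, y} (Function.update (fun _ => -1) x 1) (b := x) (by simp)
  rw [Finset.sum_pair hxy] at this
  simpa [Function.update_of_ne hxy.symm, ← sub_eq_add_neg, Subtype.dist_eq, dist_eq_norm] using this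

theorem IsOrthonormalSchauderBasis.isOrthonormalSet {B : Set V}
    (hB : IsOrthonormalSchauderBasis k B) : IsOrthonormalSet k B := by
  classical
  refine ⟨hB.norm_eq_one, fun s hs c b hb => ?_⟩
  set c' : B → k := fun e => if (e : V) ∈ s then c e else 0 with hc'
  have hfin : (Function.support c').Finite := by
    refine (s.finite_toSet.preimage (Subtype.val_injective.injOn (s := Set.univ)
      |>.mono (Set.subset_univ _))).subset fun e he => ?_
    by_contra hne
    exact he (if_neg hne)
  have ht : Tendsto c' cofinite (𝓝 0) := tendsto_cofinite_zero_of_finite_support hfin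
  obtain ⟨v, hv, hn⟩ := hB.norm_sum c' ht
  have hv' : HasSum (fun e : B => c' e • (e : V)) (∑ x ∈ s, c x • x) := by
    have : ∑ x ∈ s, c x • x = ∑ e ∈ s.subtype (· ∈ B), c' e • (e : V) := by
      rw [Finset.sum_subtype_eq_sum_filter (p := (· ∈ B))
        (f := fun x => (if x ∈ s then c x else 0) • x), Finset.filter_true_of_mem fun x hx => hs hx]
      exact Finset.sum_congr rfl fun x hx => by simp [hx]
    rw [this]
    refine hasSum_sum_of_ne_finset_zero fun e he => ?_
    have : (e : V) ∉ s := fun h => he (Finset.mem_subtype.2 h)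
    simp [hc', this]
  rw [← hv.unique hv', hn]
  have hbdd : BddAbove (Set.range fun e : B => ‖c' e‖) := by
    have h1 : Tendsto (fun e => ‖c' e‖) cofinite (𝓝 0) := tendsto_zero_iff_norm_tendsto_zero.1 ht
    exact h1.bddAbove_range_of_cofinite
  have := le_ciSup hbdd ⟨b, hs hb⟩
  simpa [hc', hb] using this

theorem IsOrthonormalSchauderBasis.closedSpan_eq_top {B : Set V}
    (hB : IsOrthonormalSchauderBasis k B) : closedSpan k B = ⊤ := by
  refine eq_top_iff.2 fun v _ => ?_
  obtain ⟨c, -, hv⟩ := hB.expansion v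
  refine (isClosed_closedSpan B).mem_of_tendsto hv ?_
  exact Eventually.of_forall fun F => Submodule.sum_mem _ fun e _ =>
      Submodule.smul_mem _ _ (subset_closedSpan B e.2)

theorem zeroAtInfty_norm_eq {ι : Type*} [TopologicalSpace ι] (f : C₀(ι, k)) :
    ‖f‖ = ⨆ i, ‖f i‖ :=
  f.toBCF.norm_eq_iSup_norm

variable [IsUltrametricDist V]

theorem norm_add_eq_max_of_norm_le {x y : V} (h : ‖y‖ ≤ ‖x + y‖) : ‖x + y‖ = max ‖x‖ ‖y‖ := by
  refine le_antisymm (IsUltrametricDist.norm_add_le_max x y) (max_le ?_ h)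
  calc ‖x‖ = ‖(x + y) - y‖ := by simp
    _ ≤ max ‖x + y‖ ‖y‖ := by
      simpa only [sub_eq_add_neg, norm_neg] using IsUltrametricDist.norm_add_le_max (x + y) (-y)
    _ ≤ ‖x + y‖ := max_le le_rfl h

/-- The summands of a sum are bounded by the sum if, at each stage of the linear order, the new
summand is bounded by its sum with any combination of the earlier ones. -/
theorem norm_le_norm_sum_of_norm_le {I : Type w} [LinearOrder I] (W : I → Submodule k V)
    (h : ∀ i, ∀ d ∈ ⨆ j : Set.Iio i, W j, ∀ w ∈ W i, ‖w‖ ≤ ‖d + w‖) (F : Finset I) :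
    ∀ x : I → V, (∀ i ∈ F, x i ∈ W i) → ∀ i ∈ F, ‖x i‖ ≤ ‖∑ j ∈ F, x j‖ := by
  classical
  induction F using Finset.induction_on_max with
  | empty => simp
  | insert a s ha ih =>
    intro x hx i hi
    have has : a ∉ s := fun h => lt_irrefl _ (ha a h)
    rw [Finset.sum_insert has, add_comm]
    have hd : ∑ j ∈ s, x j ∈ ⨆ j : Set.Iio a, W j := Submodule.sum_mem _ fun j hj =>
      Submodule.mem_iSup_of_mem (⟨j, ha j hj⟩ : Set.Iio a) (hx j (Finset.mem_insert_of_mem hj))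
    have h1 := h a _ hd (x a) (hx a (Finset.mem_insert_self _ _))
    rcases Finset.mem_insert.1 hi with rfl | hi
    · exact h1
    · rw [norm_add_eq_max_of_norm_le h1]
      exact (ih x (fun j hj => hx j (Finset.mem_insert_of_mem hj)) i hi).trans (le_max_left _ _)

/-- A union of orthonormal sets, indexed by a linear order, is orthonormal if each of them is
orthogonal to the span of the earlier ones. -/
theorem isOrthonormalSet_iUnion {I : Type w} [LinearOrder I] {B : I → Set V}
    (hB : ∀ i, IsOrthonormalSet k (B i))
    (h : ∀ i, ∀ d ∈ Submodule.span k (⋃ j : Set.Iio i, B j), ∀ w ∈ Submodule.span k (B i),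
      ‖w‖ ≤ ‖d + w‖) : IsOrthonormalSet k (⋃ i, B i) := by
  classical
  refine ⟨fun b hb => ?_, fun s hs c b hb => ?_⟩
  · obtain ⟨i, hi⟩ := Set.mem_iUnion.1 hb
    exact (hB i).norm_eq_one b hi
  · have hs' : ∀ x : V, x ∈ s → ∃ i, x ∈ B i := fun x hx => Set.mem_iUnion.1 (hs hx)
    obtain ⟨i₀, -⟩ := hs' b hb
    have : ∃ f : V → I, ∀ x ∈ s, x ∈ B (f x) := by
      refine ⟨fun x => if hx : x ∈ s then (hs' x hx).choose else i₀, fun x hx => ?_⟩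
      simp only [hx, dif_pos]
      exact (hs' x hx).choose_spec
    obtain ⟨f, hf⟩ := this
    have hfib : ∀ i, ((s.filter fun x => f x = i : Finset V) : Set V) ⊆ B i := by
      rintro i x hx
      obtain ⟨hxs, rfl⟩ := Finset.mem_filter.1 hx
      exact hf x hxs
    rw [← Finset.sum_fiberwise_of_maps_to (t := s.image f)
      (fun x hx => Finset.mem_image_of_mem f hx)]
    refine ((hB (f b)).norm_coeff_le _ (hfib (f b)) c b (by simp [hb])).trans ?_
    refine norm_le_norm_sum_of_norm_le (fun i => Submodule.span k (B i)) ?_ (s.image f)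
      (fun i => ∑ x ∈ s with f x = i, c x • x) ?_ (f b) (Finset.mem_image_of_mem f hb)
    · intro i d hd w hw
      rw [← Submodule.span_iUnion] at hd
      exact h i d hd w hw
    · exact fun i _ => Submodule.sum_mem _ fun x hx =>
        Submodule.smul_mem _ _ (Submodule.subset_span (hfib i hx))

/-- The union of two orthonormal sets with orthogonal spans is orthonormal. -/
theorem IsOrthonormalSet.union {B B' : Set V} (hB : IsOrthonormalSet k B)
    (hB' : IsOrthonormalSet k B')
    (h : ∀ d ∈ Submodule.span k B, ∀ w ∈ Submodule.span k B', ‖w‖ ≤ ‖d + w‖) :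
    IsOrthonormalSet k (B ∪ B') := by
  have : B ∪ B' = ⋃ i : Bool, cond i B' B := by
    ext x; simp
  rw [this]
  refine isOrthonormalSet_iUnion (fun i => by cases i <;> assumption) fun i d hd w hw => ?_
  cases i with
  | false =>
    have : (⋃ j : Set.Iio false, (cond (j : Bool) B' B)) = ∅ := by
      ext x; simp
    rw [this, Submodule.span_empty, Submodule.mem_bot] at hd
    simp [hd]
  | true =>
    refine h d (Submodule.span_mono ?_ hd) w hw
    rintro x hx
    simpa using hx

/-- A family of coefficients tending to zero defines a convergent series, because the space is
complete and ultrametric, and finite orthonormality passes to the limit. -/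
theorem IsOrthonormalSet.norm_sum_eq {B : Set V} (hB : IsOrthonormalSet k B) [CompleteSpace V]
    (c : B → k) (hc : Tendsto c cofinite (𝓝 0)) :
    ∃ s : V, HasSum (fun e : B => c e • (e : V)) s ∧ ‖s‖ = ⨆ e : B, ‖c e‖ := by
  have hn : ∀ e : B, ‖c e • (e : V)‖ = ‖c e‖ := fun e => by
    rw [norm_smul, hB.norm_eq_one e e.2, mul_one]
  have hsum : Summable (fun e : B => c e • (e : V)) := by
    apply NonarchimedeanAddGroup.summable_of_tendsto_cofinite_zero
    rw [tendsto_zero_iff_norm_tendsto_zero] at hc ⊢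
    simpa only [hn] using hc
  obtain ⟨s, hs⟩ := hsum
  have hbdd : BddAbove (Set.range fun e : B => ‖c e‖) := by
    have h1 : Tendsto (fun e => ‖c e‖) cofinite (𝓝 0) := tendsto_zero_iff_norm_tendsto_zero.1 hc
    exact h1.bddAbove_range_of_cofinite
  refine ⟨s, hs, le_antisymm ?_ ?_⟩
  · refine le_of_tendsto hs.norm (Eventually.of_forall fun F => ?_)
    refine IsUltrametricDist.norm_sum_le_of_forall_le_of_nonneg
      (Real.iSup_nonneg fun _ => norm_nonneg _) fun e _ => ?_
    rw [hn]
    exact le_ciSup hbdd e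
  · refine Real.iSup_le (fun e => ?_) (norm_nonneg _)
    refine ge_of_tendsto hs.norm ?_
    filter_upwards [Filter.eventually_ge_atTop {e}] with F hF
    exact hB.norm_coeff_le_subtype F c (hF (Finset.mem_singleton_self e))

/-- The linear isometry `c ↦ ∑ c e • e` given by an orthonormal set. -/
noncomputable def IsOrthonormalSet.synthesis {B : Set V} (hB : IsOrthonormalSet k B)
    [CompleteSpace V] [DiscreteTopology B] : C₀(B, k) →ₗᵢ[k] V :=
  have key : ∀ f : C₀(B, k), HasSum (fun e : B => f e • (e : V)) (∑' e : B, f e • (e : V)) ∧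
      ‖∑' e : B, f e • (e : V)‖ = ⨆ e : B, ‖f e‖ := fun f => by
    have hf : Tendsto f cofinite (𝓝 0) := by
      rw [← Filter.cocompact_eq_cofinite]
      exact f.zero_at_infty'
    obtain ⟨s, hs, hs'⟩ := hB.norm_sum_eq f hf
    rw [hs.tsum_eq]
    exact ⟨hs, hs'⟩
  { toFun := fun f => ∑' e : B, f e • (e : V)
    map_add' := fun f g => by
      rw [← ((key f).1.add (key g).1).tsum_eq]
      simp [add_smul]
    map_smul' := fun a f => by
      rw [RingHom.id_apply, ← ((key f).1.const_smul a).tsum_eq]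
      simp [mul_smul]
    norm_map' := fun f => by
      rw [zeroAtInfty_norm_eq]
      exact (key f).2 }

theorem IsOrthonormalSet.hasSum_synthesis {B : Set V} (hB : IsOrthonormalSet k B)
    [CompleteSpace V] [DiscreteTopology B] (f : C₀(B, k)) :
    HasSum (fun e : B => f e • (e : V)) (hB.synthesis f) := by
  have hf : Tendsto f cofinite (𝓝 0) := by
    rw [← Filter.cocompact_eq_cofinite]
    exact f.zero_at_infty'
  obtain ⟨s, hs, -⟩ := hB.norm_sum_eq f hf
  have : hB.synthesis f = ∑' e : B, f e • (e : V) := rfl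
  rwa [this, hs.tsum_eq]

theorem IsOrthonormalSet.range_synthesis [CompleteSpace k] [CompleteSpace V] {B : Set V}
    (hB : IsOrthonormalSet k B) [DiscreteTopology B] :
    LinearMap.range hB.synthesis.toLinearMap = closedSpan k B := by
  classical
  apply le_antisymm
  · rintro _ ⟨f, rfl⟩
    refine (isClosed_closedSpan B).mem_of_tendsto (hB.hasSum_synthesis f) ?_
    exact Eventually.of_forall fun F => Submodule.sum_mem _ fun e _ =>
      Submodule.smul_mem _ _ (subset_closedSpan B e.2)
  · refine closedSpan_le ?_ fun b hb => ?_
    · exact hB.synthesis.isometry.isClosedEmbedding.isClosed_range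
    · let g : B → k := Pi.single ⟨b, hb⟩ 1
      have hg : ∀ e, e ≠ ⟨b, hb⟩ → g e = 0 := fun e he => Pi.single_eq_of_ne he _
      let f : C₀(B, k) := ⟨⟨g, continuous_of_discreteTopology⟩, by
        rw [Filter.cocompact_eq_cofinite]
        refine tendsto_cofinite_zero_of_finite_support
          ((Set.finite_singleton (⟨b, hb⟩ : B)).subset fun e he => ?_)
        by_contra hne
        exact he (hg e hne)⟩
      refine ⟨f, (hB.hasSum_synthesis f).unique ?_⟩
      have := hasSum_single (f := fun e : B => f e • (e : V)) ⟨b, hb⟩ fun e he => by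
        have : f e = 0 := hg e he
        simp [this]
      have h1 : f ⟨b, hb⟩ = 1 := Pi.single_eq_same _ _
      simpa [h1] using this

theorem IsOrthonormalSet.isOrthonormalSchauderBasis [CompleteSpace k] [CompleteSpace V] {B : Set V}
    (hB : IsOrthonormalSet k B) (h : closedSpan k B = ⊤) : IsOrthonormalSchauderBasis k B := by
  have := hB.discreteTopology
  refine ⟨hB.norm_eq_one, hB.norm_sum_eq, fun v => ?_⟩
  obtain ⟨f, rfl⟩ : v ∈ LinearMap.range hB.synthesis.toLinearMap := by
    rw [hB.range_synthesis, h]; trivial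
  refine ⟨f, ?_, hB.hasSum_synthesis f⟩
  rw [← Filter.cocompact_eq_cofinite]
  exact f.zero_at_infty'

/-- A free space is isometrically a space of functions tending to zero on a discrete space. -/
theorem IsFree.exists_linearIsometry [CompleteSpace k] [CompleteSpace V] (h : IsFree k V) :
    ∃ (ι : Type v) (_ : TopologicalSpace ι) (_ : DiscreteTopology ι),
      Nonempty (V →ₗᵢ[k] C₀(ι, k)) := by
  obtain ⟨B, hB⟩ := h
  have hB' := hB.isOrthonormalSet
  have := hB'.discreteTopology
  refine ⟨B, inferInstance, inferInstance, ⟨?_⟩⟩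
  refine (LinearIsometryEquiv.ofSurjective hB'.synthesis fun v => ?_).symm.toLinearIsometry
  have : v ∈ LinearMap.range hB'.synthesis.toLinearMap := by
    rw [hB'.range_synthesis, hB.closedSpan_eq_top]; trivial
  exact this

end Orthonormal

/-! ### Functions tending to zero on a discrete space -/

section ZeroAtInfty

variable {k : Type u} [NormedField k] {ι : Type w} [TopologicalSpace ι]

theorem zeroAtInfty_norm_le_iff {f : C₀(ι, k)} {r : ℝ} (hr : 0 ≤ r) :
    ‖f‖ ≤ r ↔ ∀ i, ‖f i‖ ≤ r :=
  BoundedContinuousFunction.norm_le (f := f.toBCF) hr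

theorem zeroAtInfty_norm_apply_le (f : C₀(ι, k)) (i : ι) : ‖f i‖ ≤ ‖f‖ :=
  (zeroAtInfty_norm_le_iff (norm_nonneg f)).1 le_rfl i

instance zeroAtInfty_isUltrametricDist [IsUltrametricDist k] : IsUltrametricDist C₀(ι, k) :=
  IsUltrametricDist.isUltrametricDist_of_forall_norm_add_le_max_norm fun f g =>
    (zeroAtInfty_norm_le_iff (le_max_of_le_left (norm_nonneg f))).2 fun i =>
      (IsUltrametricDist.norm_add_le_max (f i) (g i)).trans
        (max_le_max (zeroAtInfty_norm_apply_le f i) (zeroAtInfty_norm_apply_le g i))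

variable (k) in
/-- The functions that vanish outside `A`. -/
def supportedOn (A : Set ι) : Submodule k C₀(ι, k) where
  carrier := {f | ∀ i ∉ A, f i = 0}
  add_mem' hf hg i hi := by simp [hf i hi, hg i hi]
  zero_mem' i _ := rfl
  smul_mem' c f hf i hi := by simp [hf i hi]

theorem supportedOn_mono {A A' : Set ι} (h : A ⊆ A') : supportedOn k A ≤ supportedOn k A' :=
  fun _ hf i hi => hf i fun hi' => hi (h hi')

variable [DiscreteTopology ι]

theorem zeroAtInfty_finite_lt_norm (f : C₀(ι, k)) {r : ℝ} (hr : 0 < r) :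
    {i | r < ‖f i‖}.Finite := by
  have h : Tendsto f cofinite (𝓝 0) := by
    rw [← Filter.cocompact_eq_cofinite]
    exact f.zero_at_infty'
  have := (tendsto_zero_iff_norm_tendsto_zero.1 h).eventually (gt_mem_nhds hr)
  exact this.subset fun i (hi : r < ‖f i‖) (hi' : ‖f i‖ < r) => lt_asymm hi hi'

theorem zeroAtInfty_countable_support (f : C₀(ι, k)) : {i | f i ≠ 0}.Countable := by
  have : {i | f i ≠ 0} = ⋃ n : ℕ, {i | 1 / ((n : ℝ) + 1) < ‖f i‖} := by
    ext i
    simp only [Set.mem_ofPred_eq, Set.mem_iUnion]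
    constructor
    · exact fun h => exists_nat_one_div_lt (norm_pos_iff.2 h)
    · rintro ⟨n, hn⟩
      exact norm_pos_iff.1 (Nat.one_div_pos_of_nat.trans hn)
  rw [this]
  exact Set.countable_iUnion fun n =>
    (zeroAtInfty_finite_lt_norm f Nat.one_div_pos_of_nat).countable

theorem zeroAtInfty_exists_norm_apply_eq {f : C₀(ι, k)} (hf : f ≠ 0) : ∃ i, ‖f i‖ = ‖f‖ := by
  have hpos : 0 < ‖f‖ := norm_pos_iff.2 hf
  have hfin := zeroAtInfty_finite_lt_norm f (half_pos hpos)
  have hne : {i | ‖f‖ / 2 < ‖f i‖}.Nonempty := by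
    by_contra hempty
    have : ‖f‖ ≤ ‖f‖ / 2 := (zeroAtInfty_norm_le_iff (half_pos hpos).le).2 fun i =>
      not_lt.1 fun h => hempty ⟨i, h⟩
    linarith
  obtain ⟨i, hi, hmax⟩ := hfin.exists_maximalFor (fun i => ‖f i‖) _ hne
  refine ⟨i, le_antisymm (zeroAtInfty_norm_apply_le f i) ?_⟩
  refine (zeroAtInfty_norm_le_iff (norm_nonneg _)).2 fun j => ?_
  by_contra hlt
  push Not at hlt
  exact absurd (hmax (hi.trans hlt : ‖f‖ / 2 < ‖f j‖) hlt.le) (not_le.2 hlt)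

open Classical in
/-- The projection of `C₀(ι, k)` that replaces the values outside `A` by zero. -/
noncomputable def restrictTo (A : Set ι) : C₀(ι, k) →ₗ[k] C₀(ι, k) where
  toFun f := ⟨⟨fun i => if i ∈ A then f i else 0, continuous_of_discreteTopology⟩, by
    have h : Tendsto (fun i => ‖f i‖) (cocompact ι) (𝓝 0) :=
      tendsto_zero_iff_norm_tendsto_zero.1 f.zero_at_infty'
    refine squeeze_zero_norm (fun i => ?_) h
    by_cases hi : i ∈ A <;> simp [hi]⟩
  map_add' f g := by
    ext i
    by_cases hi : i ∈ A <;> simp [hi]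
  map_smul' c f := by
    ext i
    by_cases hi : i ∈ A <;> simp [hi]

theorem restrictTo_apply_of_mem {A : Set ι} (f : C₀(ι, k)) {i : ι} (hi : i ∈ A) :
    restrictTo A f i = f i := if_pos hi

theorem restrictTo_apply_of_notMem {A : Set ι} (f : C₀(ι, k)) {i : ι} (hi : i ∉ A) :
    restrictTo A f i = 0 := if_neg hi

theorem norm_restrictTo_le (A : Set ι) (f : C₀(ι, k)) : ‖restrictTo A f‖ ≤ ‖f‖ := by
  refine (zeroAtInfty_norm_le_iff (norm_nonneg _)).2 fun i => ?_
  by_cases hi : i ∈ A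
  · rw [restrictTo_apply_of_mem f hi]
    exact zeroAtInfty_norm_apply_le f i
  · rw [restrictTo_apply_of_notMem f hi, norm_zero]
    exact norm_nonneg _

theorem restrictTo_add_restrictTo_compl (A : Set ι) (f : C₀(ι, k)) :
    restrictTo A f + restrictTo Aᶜ f = f := by
  ext i
  by_cases hi : i ∈ A
  · simp [restrictTo_apply_of_mem f hi,
      restrictTo_apply_of_notMem (A := Aᶜ) f (Set.notMem_compl_iff.2 hi)]
  · simp [restrictTo_apply_of_notMem f hi, restrictTo_apply_of_mem (A := Aᶜ) f hi]

theorem restrictTo_mem_supportedOn (A : Set ι) (f : C₀(ι, k)) :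
    restrictTo A f ∈ supportedOn k A := fun _ hi => restrictTo_apply_of_notMem f hi

/-- A function supported on `A` is close to its restriction to a finite subset of `A`. -/
theorem exists_finset_norm_sub_restrictTo_le {A : Set ι} {f : C₀(ι, k)}
    (hf : f ∈ supportedOn k A) {r : ℝ} (hr : 0 < r) :
    ∃ J : Finset ι, (J : Set ι) ⊆ A ∧ ‖f - restrictTo (J : Set ι) f‖ ≤ r := by
  classical
  refine ⟨(zeroAtInfty_finite_lt_norm f hr).toFinset, fun i hi => ?_, ?_⟩
  · by_contra hA
    have : r < ‖f i‖ := by simpa using hi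
    rw [hf i hA, norm_zero] at this
    exact lt_asymm hr this
  · refine (zeroAtInfty_norm_le_iff hr.le).2 fun i => ?_
    by_cases hi : r < ‖f i‖
    · rw [ZeroAtInftyContinuousMap.sub_apply, restrictTo_apply_of_mem f (by simpa using hi)]
      simpa using hr.le
    · rw [ZeroAtInftyContinuousMap.sub_apply, restrictTo_apply_of_notMem f (by simpa using hi)]
      simpa using hi

end ZeroAtInfty

section CountableGeneration

theorem exists_countable_forall_exists_le {α : Type*} (N : Set α) (φ : α → ℝ) :
    ∃ T ⊆ N, T.Countable ∧ ∀ x ∈ N, ∃ t ∈ T, φ x ≤ φ t := by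
  classical
  let P : ℚ → Prop := fun q => ∃ x ∈ N, (q : ℝ) ≤ φ x
  let T₀ : Set α := Set.range fun q : {q // P q} => q.2.choose
  have hT₀ : T₀ ⊆ N := by
    rintro _ ⟨q, rfl⟩
    exact q.2.choose_spec.1
  have key : ∀ x ∈ N, (∃ y ∈ N, φ x < φ y) → ∃ t ∈ T₀, φ x ≤ φ t := by
    rintro x - ⟨y, hy, hxy⟩
    obtain ⟨q, hq, hq'⟩ := exists_rat_btwn hxy
    exact ⟨_, ⟨⟨q, y, hy, hq'.le⟩, rfl⟩, hq.le.trans (Exists.choose_spec (_ : P q)).2⟩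
  by_cases hmax : ∃ m ∈ N, ∀ y ∈ N, φ y ≤ φ m
  · obtain ⟨m, hm, hm'⟩ := hmax
    exact ⟨{m}, by simpa using hm, Set.countable_singleton m, fun x hx => ⟨m, rfl, hm' x hx⟩⟩
  · push Not at hmax
    exact ⟨T₀, hT₀, Set.countable_range _, fun x hx => key x hx (hmax x hx)⟩

variable {k : Type u} [NormedField k] {ι : Type w} [TopologicalSpace ι]

/-- Over the unit ball of `k`, every submodule of a free module of finite rank is countably
generated, because every set of values of the norm has a countable cofinal subset. -/
theorem exists_countable_generators [DecidableEq ι] (J : Finset ι) :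
    ∀ N : AddSubgroup C₀(ι, k), (∀ c : k, ‖c‖ ≤ 1 → ∀ x ∈ N, c • x ∈ N) →
      (∀ x ∈ N, ∀ i ∉ J, x i = 0) → ∃ T : Set C₀(ι, k), T ⊆ N ∧ T.Countable ∧
        ∀ M : AddSubgroup C₀(ι, k), (∀ c : k, ‖c‖ ≤ 1 → ∀ x ∈ M, c • x ∈ M) → T ⊆ M → N ≤ M := by
  induction J using Finset.induction_on with
  | empty =>
    intro N _ hN
    refine ⟨∅, by simp, Set.countable_empty, fun M _ _ x hx => ?_⟩
    have : x = 0 := by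
      ext i
      exact hN x hx i (by simp)
    rw [this]
    exact M.zero_mem
  | insert i J _ ih =>
    intro N hsmul hN
    let N₀ : AddSubgroup C₀(ι, k) :=
      { carrier := {x | x ∈ N ∧ x i = 0}
        add_mem' := fun hx hy => ⟨N.add_mem hx.1 hy.1, by simp [hx.2, hy.2]⟩
        zero_mem' := ⟨N.zero_mem, rfl⟩
        neg_mem' := fun hx => ⟨N.neg_mem hx.1, by simp [hx.2]⟩ }
    obtain ⟨T₀, hT₀, hT₀c, hgen⟩ := ih N₀
      (fun c hc x hx => ⟨hsmul c hc x hx.1, by simp [hx.2]⟩) fun x hx j hj => by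
        by_cases hji : j = i
        · rw [hji, hx.2]
        · exact hN x hx.1 j (by simp [hji, hj])
    obtain ⟨T₁, hT₁, hT₁c, hcof⟩ := exists_countable_forall_exists_le (N : Set C₀(ι, k))
      fun x => ‖x i‖
    refine ⟨T₀ ∪ T₁, Set.union_subset (hT₀.trans fun x hx => hx.1) hT₁, hT₀c.union hT₁c,
      fun M hM hTM x hx => ?_⟩
    obtain ⟨t, ht, hxt⟩ := hcof x hx
    have hc : ‖x i / t i‖ ≤ 1 := by
      rw [norm_div]
      exact div_le_one_of_le₀ hxt (norm_nonneg _)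
    have h0 : x - (x i / t i) • t ∈ N₀ := by
      refine ⟨N.sub_mem hx (hsmul _ hc t (hT₁ ht)), ?_⟩
      by_cases hti : t i = 0
      · have : x i = 0 := by simpa [hti] using hxt
        simp [this]
      · simp [hti]
    have := M.add_mem (hgen M hM (Set.subset_union_left.trans hTM) h0)
      (hM _ hc t (hTM (Or.inr ht)))
    simpa using this

theorem exists_countable_closed_under_finset {α : Type*} (Φ : Finset α → Set α)
    (hΦ : ∀ J, (Φ J).Countable) (e : α) :
    ∃ C : Set α, e ∈ C ∧ C.Countable ∧ ∀ J : Finset α, (J : Set α) ⊆ C → Φ J ⊆ C := by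
  classical
  let step : Set α → Set α := fun C => C ∪ ⋃ J ∈ {J : Finset α | (J : Set α) ⊆ C}, Φ J
  let S : ℕ → Set α := fun n => step^[n] {e}
  have hS : ∀ n, S (n + 1) = step (S n) := fun n => Function.iterate_succ_apply' _ _ _
  have hmono : Monotone S := monotone_nat_of_le_succ fun n => by
    rw [hS]
    exact Set.subset_union_left
  have hcount : ∀ n, (S n).Countable := by
    intro n
    induction n with
    | zero => exact Set.countable_singleton e
    | succ n ih =>
      rw [hS]
      have hfin : {J : Finset α | (J : Set α) ⊆ S n}.Countable := by
        refine ((Set.countable_ofPred_finite_subset ih).preimage_of_injOn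
          (f := fun J : Finset α => (J : Set α)) Finset.coe_injective.injOn).mono ?_
        exact fun J hJ => ⟨J.finite_toSet, hJ⟩
      exact ih.union (hfin.biUnion fun J _ => hΦ J)
  refine ⟨⋃ n, S n, Set.mem_iUnion.2 ⟨0, rfl⟩, Set.countable_iUnion hcount, fun J hJ => ?_⟩
  obtain ⟨n, hn⟩ := hmono.directed_le.exists_mem_subset_of_finset_subset_biUnion hJ
  refine Set.Subset.trans ?_ (Set.subset_iUnion S (n + 1))
  rw [hS]
  exact fun x hx =>
    Or.inr (Set.mem_biUnion (show J ∈ {J : Finset α | (J : Set α) ⊆ S n} from hn) hx)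

end CountableGeneration

/-! ### Countable approximation and orthonormalization -/

section Subspaces

variable {k : Type u} [NormedField k] [IsUltrametricDist k] {ι : Type w} [TopologicalSpace ι]
  [DiscreteTopology ι]

/-- Every index lies in a countable set `C` such that, to approximate functions supported on `C` by
elements of `W`, linear combinations of countably many elements of `W` supported on `C` suffice. -/
theorem exists_countable_approximation (W : Submodule k C₀(ι, k)) (e : ι) :
    ∃ (C : Set ι) (T : Set C₀(ι, k)), e ∈ C ∧ T.Countable ∧ T ⊆ W ∧ T ⊆ supportedOn k C ∧
      ∀ (n : ℕ), ∀ x ∈ supportedOn k C, (∃ w ∈ W, ‖x - w‖ ≤ 1 / ((n : ℝ) + 1)) →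
        ∃ w ∈ Submodule.span k T, ‖x - w‖ ≤ 1 / ((n : ℝ) + 1) := by
  classical
  have hpos : ∀ n : ℕ, 0 < 1 / ((n : ℝ) + 1) := fun n => Nat.one_div_pos_of_nat
  -- For fixed `J` and `n`, the functions supported on `J` and close to `W` form a countably
  -- generated module over the unit ball; `T J n` approximates its generators.
  have hloc : ∀ (J : Finset ι) (n : ℕ), ∃ T : Set C₀(ι, k), T.Countable ∧ T ⊆ W ∧
      ∀ x ∈ supportedOn k (J : Set ι), (∃ w ∈ W, ‖x - w‖ ≤ 1 / ((n : ℝ) + 1)) →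
        ∃ w ∈ Submodule.span k T, ‖x - w‖ ≤ 1 / ((n : ℝ) + 1) := by
    intro J n
    let near : Submodule k C₀(ι, k) → AddSubgroup C₀(ι, k) := fun U =>
      { carrier := {x | ∃ w ∈ U, ‖x - w‖ ≤ 1 / ((n : ℝ) + 1)}
        add_mem' := by
          rintro x y ⟨w, hw, hxw⟩ ⟨w', hw', hyw⟩
          refine ⟨w + w', U.add_mem hw hw', ?_⟩
          rw [add_sub_add_comm]
          exact (IsUltrametricDist.norm_add_le_max _ _).trans (max_le hxw hyw)
        zero_mem' := ⟨0, U.zero_mem, by simpa using (hpos n).le⟩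
        neg_mem' := by
          rintro x ⟨w, hw, hxw⟩
          refine ⟨-w, U.neg_mem hw, ?_⟩
          rwa [← neg_sub', norm_neg] }
    have hnear : ∀ U, ∀ c : k, ‖c‖ ≤ 1 → ∀ x ∈ near U, c • x ∈ near U := by
      rintro U c hc x ⟨w, hw, hxw⟩
      refine ⟨c • w, U.smul_mem c hw, ?_⟩
      have hcx : c • x - c • w = c • (x - w) := (smul_sub c x w).symm
      rw [hcx, norm_smul]
      exact (mul_le_of_le_one_left (norm_nonneg _) hc).trans hxw
    obtain ⟨X, hX, hXc, hgen⟩ := exists_countable_generators J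
      (near W ⊓ (supportedOn k (J : Set ι)).toAddSubgroup)
      (fun c hc x hx => ⟨hnear W c hc x hx.1, (supportedOn k (J : Set ι)).smul_mem c hx.2⟩)
      (fun x hx i hi => hx.2 i (by simpa using hi))
    have hX' : ∀ x : X, ∃ w ∈ W, ‖(x : C₀(ι, k)) - w‖ ≤ 1 / ((n : ℝ) + 1) := fun x => (hX x.2).1
    choose f hfW hf using hX'
    have := hXc.to_subtype
    refine ⟨Set.range f, Set.countable_range f, by rintro _ ⟨x, rfl⟩; exact hfW x,
      fun x hx hxW => ?_⟩
    exact hgen (near (Submodule.span k (Set.range f))) (hnear _)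
      (fun x hx => ⟨f ⟨x, hx⟩, Submodule.subset_span ⟨_, rfl⟩, hf ⟨x, hx⟩⟩) ⟨hxW, hx⟩
  choose T hTc hTW hT using hloc
  obtain ⟨C, heC, hCc, hC⟩ := exists_countable_closed_under_finset
    (fun J => ⋃ n, ⋃ w ∈ T J n, {i | w i ≠ 0})
    (fun J => Set.countable_iUnion fun n => (hTc J n).biUnion fun w _ =>
      zeroAtInfty_countable_support w) e
  have hfin : {J : Finset ι | (J : Set ι) ⊆ C}.Countable := by
    refine ((Set.countable_ofPred_finite_subset hCc).preimage_of_injOn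
      (f := fun J : Finset ι => (J : Set ι)) Finset.coe_injective.injOn).mono ?_
    exact fun J hJ => ⟨J.finite_toSet, hJ⟩
  refine ⟨C, ⋃ J ∈ {J : Finset ι | (J : Set ι) ⊆ C}, ⋃ n, T J n, heC,
    hfin.biUnion fun J _ => Set.countable_iUnion fun n => hTc J n,
    Set.iUnion₂_subset fun J _ => Set.iUnion_subset fun n => hTW J n, ?_, ?_⟩
  · refine Set.iUnion₂_subset fun J hJ => Set.iUnion_subset fun n w hw i hi => ?_
    by_contra hwi
    exact hi (hC J hJ (Set.mem_iUnion.2 ⟨n, Set.mem_biUnion hw hwi⟩))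
  · rintro n x hx ⟨w, hw, hxw⟩
    obtain ⟨J, hJC, hJ⟩ := exists_finset_norm_sub_restrictTo_le hx (hpos n)
    obtain ⟨w', hw', hxw'⟩ := hT J n (restrictTo (J : Set ι) x) (restrictTo_mem_supportedOn _ _)
      ⟨w, hw, by
        rw [← sub_add_sub_cancel _ x w]
        refine (IsUltrametricDist.norm_add_le_max _ _).trans (max_le ?_ hxw)
        rwa [norm_sub_rev]⟩
    refine ⟨w', Submodule.span_mono ?_ hw', ?_⟩
    · exact (Set.subset_iUnion _ n).trans (Set.subset_biUnion_of_mem (u := fun J => ⋃ n, T J n)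
        (show J ∈ {J : Finset ι | (J : Set ι) ⊆ C} from hJC))
    · rw [← sub_add_sub_cancel _ (restrictTo (J : Set ι) x) w']
      exact (IsUltrametricDist.norm_add_le_max _ _).trans (max_le hJ hxw')

/-- Finite-dimensional subspaces of `C₀(ι, k)` are images of projections of norm at most one. A
vector is added to the subspace by means of a coordinate at which its remainder attains its norm. -/
theorem exists_projection_span_finset (F : Finset C₀(ι, k)) :
    ∃ π : C₀(ι, k) →ₗ[k] C₀(ι, k), (∀ x, ‖π x‖ ≤ ‖x‖) ∧
      (∀ x, π x ∈ Submodule.span k (F : Set C₀(ι, k))) ∧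
      ∀ x ∈ Submodule.span k (F : Set C₀(ι, k)), π x = x := by
  classical
  induction F using Finset.induction_on with
  | empty =>
    refine ⟨0, fun x => by simp, fun x => Submodule.zero_mem _, fun x hx => ?_⟩
    have : x = 0 := by simpa using hx
    simp [this]
  | insert a F _ ih =>
    obtain ⟨π, hle, hmem, hfix⟩ := ih
    have hmono : Submodule.span k (F : Set C₀(ι, k)) ≤
        Submodule.span k ((insert a F : Finset C₀(ι, k)) : Set C₀(ι, k)) :=
      Submodule.span_mono (by simp)
    have hspan : ∀ π' : C₀(ι, k) →ₗ[k] C₀(ι, k), π' a = a → (∀ x ∈ F, π' x = x) →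
        ∀ x ∈ Submodule.span k ((insert a F : Finset C₀(ι, k)) : Set C₀(ι, k)), π' x = x := by
      intro π' ha hF x hx
      have : Set.EqOn π' (LinearMap.id : C₀(ι, k) →ₗ[k] C₀(ι, k))
          ((insert a F : Finset C₀(ι, k)) : Set C₀(ι, k)) := by
        intro y hy
        rcases Finset.mem_insert.1 (Finset.mem_coe.1 hy) with rfl | hy
        · exact ha
        · exact hF y hy
      exact LinearMap.eqOn_span this hx
    have hF : ∀ x ∈ F, π x = x := fun x hx => hfix x (Submodule.subset_span hx)
    set y := a - π a with hy
    have hπy : π y = 0 := by rw [hy, map_sub, hfix _ (hmem a), sub_self]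
    by_cases hy0 : y = 0
    · exact ⟨π, hle, fun x => hmono (hmem x), hspan π (sub_eq_zero.1 (hy ▸ hy0)).symm hF⟩
    · obtain ⟨i, hi⟩ := zeroAtInfty_exists_norm_apply_eq hy0
      have hyi : y i ≠ 0 := norm_pos_iff.1 (hi ▸ norm_pos_iff.2 hy0)
      let φ : C₀(ι, k) →ₗ[k] C₀(ι, k) :=
        { toFun := fun x => ((x - π x) i / y i) • y
          map_add' := fun x x' => by
            ext j
            simp only [map_add, ZeroAtInftyContinuousMap.smul_apply,
              ZeroAtInftyContinuousMap.sub_apply, ZeroAtInftyContinuousMap.add_apply, smul_eq_mul]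
            ring
          map_smul' := fun c x => by
            ext j
            simp only [map_smul, ZeroAtInftyContinuousMap.smul_apply,
              ZeroAtInftyContinuousMap.sub_apply, smul_eq_mul, RingHom.id_apply]
            ring }
      have hφ : ∀ x, φ x = ((x - π x) i / y i) • y := fun x => rfl
      have hya : y ∈ Submodule.span k ((insert a F : Finset C₀(ι, k)) : Set C₀(ι, k)) :=
        Submodule.sub_mem _ (Submodule.subset_span (by simp)) (hmono (hmem a))
      refine ⟨π + φ, fun x => ?_, fun x => ?_, hspan _ ?_ fun x hx => ?_⟩
      · refine (IsUltrametricDist.norm_add_le_max _ _).trans (max_le (hle x) ?_)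
        rw [hφ, norm_smul, norm_div, hi, div_mul_cancel₀ _ (norm_ne_zero_iff.2 hy0)]
        refine (zeroAtInfty_norm_apply_le _ i).trans ?_
        rw [sub_eq_add_neg]
        refine (IsUltrametricDist.norm_add_le_max _ _).trans (max_le le_rfl ?_)
        rw [norm_neg]
        exact hle x
      · exact Submodule.add_mem _ (hmono (hmem x)) (Submodule.smul_mem _ _ hya)
      · rw [LinearMap.add_apply, hφ, ← hy, div_self hyi, one_smul, hy, add_sub_cancel]
      · rw [LinearMap.add_apply, hφ, hF x hx]
        simp

/-- The Gram–Schmidt process for countably many vectors of `C₀(ι, k)`. -/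
theorem exists_isOrthonormalSet_span_eq {T : Set C₀(ι, k)} (hT : T.Countable) :
    ∃ B : Set C₀(ι, k), IsOrthonormalSet k B ∧ Submodule.span k B = Submodule.span k T := by
  classical
  rcases T.eq_empty_or_nonempty with rfl | hne
  · exact ⟨∅, isOrthonormalSet_empty, rfl⟩
  obtain ⟨x, rfl⟩ := hT.exists_eq_range hne
  choose π hle hmem hfix using fun n : ℕ => exists_projection_span_finset (k := k)
    ((Finset.range n).image x)
  set D : ℕ → Submodule k C₀(ι, k) := fun n =>
    Submodule.span k (((Finset.range n).image x : Finset C₀(ι, k)) : Set C₀(ι, k)) with hD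
  have hDmono : Monotone D := fun m n hmn => Submodule.span_mono (by
    exact_mod_cast Finset.image_subset_image (Finset.range_mono hmn))
  have hxD : ∀ n, x n ∈ D (n + 1) := fun n =>
    Submodule.subset_span (by
      exact_mod_cast Finset.mem_image_of_mem x (Finset.self_mem_range_succ n))
  set y : ℕ → C₀(ι, k) := fun n => x n - π n (x n) with hy
  have hyD : ∀ n, y n ∈ D (n + 1) := fun n =>
    Submodule.sub_mem _ (hxD n) (hDmono n.le_succ (hmem n _))
  have hπy : ∀ n, π n (y n) = 0 := fun n => by
    simp only [hy, map_sub, hfix n _ (hmem n (x n)), sub_self]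
  have hnorm : ∀ n, ∃ c : k, y n ≠ 0 → c ≠ 0 ∧ ‖c • y n‖ = 1 := by
    intro n
    by_cases h0 : y n = 0
    · exact ⟨0, fun h => absurd h0 h⟩
    · obtain ⟨i, hi⟩ := zeroAtInfty_exists_norm_apply_eq h0
      have hn := norm_ne_zero_iff.2 h0
      have hi0 : y n i ≠ 0 := norm_ne_zero_iff.1 (hi ▸ hn)
      exact ⟨(y n i)⁻¹, fun _ => ⟨inv_ne_zero hi0, by
        rw [norm_smul, norm_inv, hi, inv_mul_cancel₀ hn]⟩⟩
  choose c hc using hnorm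
  set B : ℕ → Set C₀(ι, k) := fun n => {b | b = c n • y n ∧ y n ≠ 0} with hB
  have hBD : ∀ n, B n ⊆ D (n + 1) := by
    rintro n _ ⟨rfl, -⟩
    exact Submodule.smul_mem _ _ (hyD n)
  have hπB : ∀ n, ∀ w ∈ Submodule.span k (B n), π n w = 0 := by
    intro n
    change Submodule.span k (B n) ≤ LinearMap.ker (π n)
    rw [Submodule.span_le]
    rintro _ ⟨rfl, -⟩
    simp [hπy]
  refine ⟨⋃ n, B n, isOrthonormalSet_iUnion (fun n => ⟨?_, ?_⟩) ?_, le_antisymm ?_ ?_⟩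
  · rintro _ ⟨rfl, h⟩
    exact (hc n h).2
  · intro s hs a b hb
    have hsb : s = {b} := Finset.eq_singleton_iff_unique_mem.2
      ⟨hb, fun b' hb' => (hs hb').1.trans (hs hb).1.symm⟩
    obtain ⟨rfl, h⟩ := hs hb
    rw [hsb, Finset.sum_singleton, norm_smul, (hc n h).2, mul_one]
  · intro n d hd w hw
    have hdD : d ∈ D n := by
      refine Submodule.span_le.2 (Set.iUnion_subset fun j => ?_) hd
      exact (hBD j).trans (hDmono (Nat.succ_le_of_lt j.2))
    have hw' : w = (d + w) - π n (d + w) := by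
      rw [map_add, hπB n w hw, hfix n d hdD, add_zero, add_sub_cancel_left]
    calc ‖w‖ = ‖(d + w) + -(π n (d + w))‖ := by rw [← sub_eq_add_neg, ← hw']
      _ ≤ ‖d + w‖ := (IsUltrametricDist.norm_add_le_max _ _).trans
        (max_le le_rfl (by rw [norm_neg]; exact hle n _))
  · refine Submodule.span_le.2 (Set.iUnion_subset fun n => (hBD n).trans ?_)
    refine Submodule.span_mono fun z hz => ?_
    obtain ⟨j, -, rfl⟩ := Finset.mem_image.1 (Finset.mem_coe.1 hz)
    exact ⟨j, rfl⟩
  · have hDB : ∀ n, D n ≤ Submodule.span k (⋃ n, B n) := by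
      intro n
      induction n with
      | zero => simp [hD]
      | succ n ih =>
        refine Submodule.span_le.2 fun z hz => ?_
        obtain ⟨j, hj, rfl⟩ := Finset.mem_image.1 (Finset.mem_coe.1 hz)
        rcases Nat.lt_succ_iff_lt_or_eq.1 (Finset.mem_range.1 hj) with hj | rfl
        · exact ih (Submodule.subset_span (by
            exact_mod_cast Finset.mem_image_of_mem x (Finset.mem_range.2 hj)))
        · have hx : x j = π j (x j) + y j := by simp [hy]
          rw [hx]
          refine Submodule.add_mem _ (ih (hmem j _)) ?_
          by_cases h0 : y j = 0
          · rw [h0]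
            exact Submodule.zero_mem _
          · have h1 : c j • y j ∈ Submodule.span k (⋃ n, B n) :=
              Submodule.subset_span (Set.mem_iUnion.2 ⟨j, rfl, h0⟩)
            have := Submodule.smul_mem _ (c j)⁻¹ h1
            rwa [smul_smul, inv_mul_cancel₀ (hc j h0).1, one_smul] at this
    rw [Submodule.span_le]
    rintro _ ⟨n, rfl⟩
    exact hDB (n + 1) (hxD n)

end Subspaces

/-! ### Closed subspaces of free spaces -/

section Subspaces

variable {k : Type u} [NormedField k] [IsUltrametricDist k] {ι : Type w} [TopologicalSpace ι]

/-- `W` is approximated within `A` if functions supported on `A` that are close to `W` are equally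
close to elements of `W` supported on `A`. The inequalities are not strict: the case `n = 0`
then lifts unit vectors to unit vectors, although distances to `W` need not be attained. -/
def IsApproximatedWithin (W : Submodule k C₀(ι, k)) (A : Set ι) : Prop :=
  ∀ (n : ℕ), ∀ x ∈ supportedOn k A, (∃ w ∈ W, ‖x - w‖ ≤ 1 / ((n : ℝ) + 1)) →
    ∃ w ∈ W ⊓ supportedOn k A, ‖x - w‖ ≤ 1 / ((n : ℝ) + 1)

/-- A partial orthonormal basis of `W`: an orthonormal basis of the part supported on a set `A`
within which `W` is approximated. -/
structure IsPartialBasis (W : Submodule k C₀(ι, k)) (A : Set ι) (B : Set C₀(ι, k)) : Prop where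
  approximated : IsApproximatedWithin W A
  orthonormal : IsOrthonormalSet k B
  subset : B ⊆ (W ⊓ supportedOn k A : Submodule k C₀(ι, k))
  le_closedSpan : W ⊓ supportedOn k A ≤ closedSpan k B

theorem isPartialBasis_empty (W : Submodule k C₀(ι, k)) : IsPartialBasis W ∅ ∅ := by
  have h0 : ∀ x ∈ supportedOn k (∅ : Set ι), x = 0 := fun x hx => by
    ext i
    exact hx i (Set.notMem_empty i)
  refine ⟨fun n x hx _ => ⟨0, Submodule.zero_mem _, ?_⟩, isOrthonormalSet_empty, by simp,
    fun w hw => ?_⟩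
  · rw [h0 x hx, sub_zero, norm_zero]
    exact Nat.one_div_pos_of_nat.le
  · rw [h0 w hw.2]
    exact Submodule.zero_mem _

variable [DiscreteTopology ι]

theorem IsApproximatedWithin.exists_norm_sub_le {W : Submodule k C₀(ι, k)} {A : Set ι}
    (hA : IsApproximatedWithin W A) (n : ℕ) {w : C₀(ι, k)} (hw : w ∈ W)
    (h : ‖restrictTo Aᶜ w‖ ≤ 1 / ((n : ℝ) + 1)) :
    ∃ z ∈ W ⊓ supportedOn k A, ‖w - z‖ ≤ 1 / ((n : ℝ) + 1) := by
  have hsub : w - restrictTo A w = restrictTo Aᶜ w := by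
    rw [sub_eq_iff_eq_add', restrictTo_add_restrictTo_compl]
  obtain ⟨z, hz, hz'⟩ := hA n _ (restrictTo_mem_supportedOn A w)
    ⟨w, hw, by rwa [norm_sub_rev, hsub]⟩
  refine ⟨z, hz, ?_⟩
  rw [← sub_add_sub_cancel _ (restrictTo A w) z, hsub]
  exact (IsUltrametricDist.norm_add_le_max _ _).trans (max_le h hz')

/-- A partial basis extends to any further index: apply the countable approximation to the image
of `W` under the restriction to the complement of `A`, orthonormalize, and lift the result
to vectors of norm one, which exist because `W` is approximated within `A`. -/
theorem IsPartialBasis.exists_extension {W : Submodule k C₀(ι, k)} {A : Set ι}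
    {B : Set C₀(ι, k)} (h : IsPartialBasis W A B) (e : ι) :
    ∃ (A' : Set ι) (B' : Set C₀(ι, k)), A ⊆ A' ∧ e ∈ A' ∧ B ⊆ B' ∧ IsPartialBasis W A' B' := by
  obtain ⟨C, T, heC, hTc, hTW, hTC, hT⟩ :=
    exists_countable_approximation (W.map (restrictTo Aᶜ)) e
  obtain ⟨B₀, hB₀, hspan⟩ := exists_isOrthonormalSet_span_eq hTc
  have hB₀T : ∀ b ∈ B₀, b ∈ Submodule.span k T := fun b hb => hspan ▸ Submodule.subset_span hb
  have hTW' : Submodule.span k T ≤ W.map (restrictTo Aᶜ) := Submodule.span_le.2 hTW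
  have hTC' : Submodule.span k T ≤ supportedOn k C := Submodule.span_le.2 hTC
  -- an element of `W` whose restriction is supported on `C` is itself supported on `A ∪ C`
  have hsupp : ∀ w : C₀(ι, k), restrictTo Aᶜ w ∈ supportedOn k C → w ∈ supportedOn k (A ∪ C) := by
    intro w hw i hi
    rw [← restrictTo_apply_of_mem (A := Aᶜ) w fun h => hi (Or.inl h)]
    exact hw i fun h => hi (Or.inr h)
  have hAC : ∀ w ∈ supportedOn k (A ∪ C), restrictTo Aᶜ w ∈ supportedOn k C := by
    intro w hw i hi
    by_cases hiA : i ∈ A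
    · exact restrictTo_apply_of_notMem w fun h => h hiA
    · rw [restrictTo_apply_of_mem (A := Aᶜ) w hiA]
      exact hw i fun h => h.elim hiA hi
  have hlift : ∀ b : B₀, ∃ w ∈ W ⊓ supportedOn k (A ∪ C), restrictTo Aᶜ w = b ∧ ‖w‖ = 1 := by
    intro b
    obtain ⟨w, hw, hwb⟩ := hTW' (hB₀T b b.2)
    have hb1 := hB₀.norm_eq_one b b.2
    obtain ⟨z, hz, hwz⟩ := h.approximated.exists_norm_sub_le 0 hw (by rw [hwb, hb1]; simp)
    have hz0 : restrictTo Aᶜ z = 0 := by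
      ext i
      by_cases hi : i ∈ A
      · exact restrictTo_apply_of_notMem z fun h => h hi
      · exact (restrictTo_apply_of_mem (A := Aᶜ) z hi).trans (hz.2 i hi)
    have hres : restrictTo Aᶜ (w - z) = b := by rw [map_sub, hz0, sub_zero, hwb]
    refine ⟨w - z, ⟨W.sub_mem hw hz.1, hsupp _ (hres ▸ hTC' (hB₀T b b.2))⟩, hres,
      le_antisymm (by simpa using hwz) ?_⟩
    rw [← hb1, ← hres]
    exact norm_restrictTo_le _ _
  choose f hfW hf hf1 using hlift
  have himage : restrictTo Aᶜ '' Set.range f = B₀ := by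
    ext b
    constructor
    · rintro ⟨_, ⟨b, rfl⟩, rfl⟩
      rw [hf]
      exact b.2
    · exact fun hb => ⟨f ⟨b, hb⟩, ⟨_, rfl⟩, hf ⟨b, hb⟩⟩
  have hinj : Set.InjOn (restrictTo Aᶜ) (Set.range f) := by
    rintro _ ⟨b, rfl⟩ _ ⟨b', rfl⟩ hbb
    rw [hf, hf] at hbb
    rw [Subtype.ext hbb]
  have hresA : ∀ d ∈ supportedOn k A, restrictTo Aᶜ d = 0 := by
    intro d hd
    ext i
    by_cases hi : i ∈ A
    · exact restrictTo_apply_of_notMem d fun h => h hi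
    · exact (restrictTo_apply_of_mem (A := Aᶜ) d hi).trans (hd i hi)
  -- the restriction is isometric on the span of the lifts, as it maps them to an orthonormal set
  have hsum : ∀ s : Finset C₀(ι, k), (s : Set C₀(ι, k)) ⊆ Set.range f → ∀ c : C₀(ι, k) → k,
      ∀ b ∈ s, ‖c b‖ ≤ ‖restrictTo Aᶜ (∑ x ∈ s, c x • x)‖ := by
    classical
    intro s hs c b hb
    have hs' : ((s.image (restrictTo Aᶜ) : Finset C₀(ι, k)) : Set C₀(ι, k)) ⊆ B₀ := by
      rw [Finset.coe_image, ← himage]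
      exact Set.image_mono hs
    have := hB₀.norm_coeff_le _ hs' (fun y => c (Function.invFunOn (restrictTo Aᶜ) (Set.range f) y))
      (restrictTo Aᶜ b) (Finset.mem_image_of_mem _ hb)
    rw [Finset.sum_image (hinj.mono hs)] at this
    have hinv : ∀ x ∈ s, Function.invFunOn (restrictTo Aᶜ) (Set.range f) (restrictTo Aᶜ x) = x :=
      fun x hx => hinj.leftInvOn_invFunOn (hs hx)
    rw [hinv b hb] at this
    rwa [map_sum, Finset.sum_congr rfl fun x hx => by
      rw [map_smul, ← congrArg c (hinv x hx)]]
  refine ⟨A ∪ C, B ∪ Set.range f, Set.subset_union_left, Or.inr heC, Set.subset_union_left,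
    ⟨?_, h.orthonormal.union ⟨?_, ?_⟩ ?_, ?_, ?_⟩⟩
  · rintro n x hx ⟨w, hw, hxw⟩
    obtain ⟨w', hw', hxw'⟩ := hT n (restrictTo Aᶜ x) (hAC x hx)
      ⟨restrictTo Aᶜ w, ⟨w, hw, rfl⟩, by
        rw [← map_sub]
        exact (norm_restrictTo_le _ _).trans hxw⟩
    obtain ⟨w₁, hw₁, rfl⟩ := hTW' hw'
    have hw₁C := hsupp w₁ (hTC' hw')
    have hres : ‖restrictTo Aᶜ (w - w₁)‖ ≤ 1 / ((n : ℝ) + 1) := by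
      have : restrictTo Aᶜ (w - w₁) =
          restrictTo Aᶜ (w - x) + (restrictTo Aᶜ x - restrictTo Aᶜ w₁) := by
        rw [map_sub, map_sub]
        abel
      rw [this]
      refine (IsUltrametricDist.norm_add_le_max _ _).trans (max_le ?_ hxw')
      exact (norm_restrictTo_le _ _).trans (by rwa [norm_sub_rev])
    obtain ⟨z, hz, hz'⟩ := h.approximated.exists_norm_sub_le n (W.sub_mem hw hw₁) hres
    refine ⟨w₁ + z, ⟨W.add_mem hw₁ hz.1, Submodule.add_mem _ hw₁C
      (supportedOn_mono Set.subset_union_left hz.2)⟩, ?_⟩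
    have : x - (w₁ + z) = (x - w) + (w - w₁ - z) := by abel
    rw [this]
    exact (IsUltrametricDist.norm_add_le_max _ _).trans (max_le hxw hz')
  · rintro _ ⟨b, rfl⟩
    exact hf1 b
  · exact fun s hs c b hb => (hsum s hs c b hb).trans (norm_restrictTo_le _ _)
  · intro d hd w hw
    have hdA : d ∈ supportedOn k A :=
      (Submodule.span_le.2 fun b hb => (h.subset hb).2 : Submodule.span k B ≤ supportedOn k A) hd
    have hle : ‖w‖ ≤ ‖restrictTo Aᶜ w‖ := by
      obtain ⟨c, s, hs, -, rfl⟩ := Submodule.mem_span_iff_exists_finset_subset.1 hw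
      refine IsUltrametricDist.norm_sum_le_of_forall_le_of_nonneg (norm_nonneg _) fun b hb => ?_
      obtain ⟨b', rfl⟩ := hs hb
      rw [norm_smul, hf1, mul_one]
      exact hsum s hs c _ hb
    calc ‖w‖ ≤ ‖restrictTo Aᶜ w‖ := hle
      _ = ‖restrictTo Aᶜ (d + w)‖ := by rw [map_add, hresA d hdA, zero_add]
      _ ≤ ‖d + w‖ := norm_restrictTo_le _ _
  · rintro b (hb | ⟨b, rfl⟩)
    · exact ⟨(h.subset hb).1, supportedOn_mono Set.subset_union_left (h.subset hb).2⟩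
    · exact hfW b
  · intro w hw
    rw [mem_closedSpan_iff]
    intro ε hε
    obtain ⟨n, hn⟩ := exists_nat_one_div_lt hε
    obtain ⟨w', hw', hww'⟩ := hT n (restrictTo Aᶜ w) (hAC w hw.2)
      ⟨restrictTo Aᶜ w, ⟨w, hw.1, rfl⟩, by
        rw [sub_self, norm_zero]
        exact Nat.one_div_pos_of_nat.le⟩
    have hmap : Submodule.span k T = (Submodule.span k (Set.range f)).map (restrictTo Aᶜ) := by
      rw [Submodule.map_span, himage, hspan]
    rw [hmap] at hw'
    obtain ⟨w₁, hw₁, rfl⟩ := hw'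
    have hw₁W : w₁ ∈ W := (Submodule.span_le.2 (by
      rintro _ ⟨b, rfl⟩
      exact (hfW b).1) : Submodule.span k (Set.range f) ≤ W) hw₁
    obtain ⟨z, hz, hz'⟩ := h.approximated.exists_norm_sub_le n (W.sub_mem hw.1 hw₁W)
      (by rwa [map_sub])
    obtain ⟨z', hz'B, hzz'⟩ := mem_closedSpan_iff.1 (h.le_closedSpan hz) ε hε
    refine ⟨w₁ + z', Submodule.add_mem _ (Submodule.span_mono Set.subset_union_right hw₁)
      (Submodule.span_mono Set.subset_union_left hz'B), ?_⟩
    have : w - (w₁ + z') = (w - w₁ - z) + (z - z') := by abel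
    rw [this]
    exact (IsUltrametricDist.norm_add_le_max _ _).trans_lt (max_lt (hz'.trans_lt hn) hzz')

theorem isPartialBasis_biUnion {W : Submodule k C₀(ι, k)} {c : Set (Set ι × Set C₀(ι, k))}
    (hc : ∀ p ∈ c, IsPartialBasis W p.1 p.2) (hne : c.Nonempty) (hchain : IsChain (· ≤ ·) c) :
    IsPartialBasis W (⋃ p ∈ c, p.1) (⋃ p ∈ c, p.2) := by
  -- the restriction of `x` to a finite set is supported on a member of the chain
  have key : ∀ (n : ℕ), ∀ x ∈ supportedOn k (⋃ p ∈ c, p.1),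
      (∃ w ∈ W, ‖x - w‖ ≤ 1 / ((n : ℝ) + 1)) →
        ∃ p ∈ c, ∃ w ∈ W ⊓ supportedOn k p.1, ‖x - w‖ ≤ 1 / ((n : ℝ) + 1) := by
    rintro n x hx ⟨w, hw, hxw⟩
    obtain ⟨J, hJ, hxJ⟩ := exists_finset_norm_sub_restrictTo_le hx
      (Nat.one_div_pos_of_nat (α := ℝ) (n := n))
    obtain ⟨p, hp, hJp⟩ := DirectedOn.exists_mem_subset_of_finset_subset_biUnion hne
      (hchain.directedOn.mono fun {p q} h => h.1) hJ
    obtain ⟨z, hz, hz'⟩ := (hc p hp).approximated n (restrictTo (J : Set ι) x)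
      (supportedOn_mono hJp (restrictTo_mem_supportedOn _ _)) ⟨w, hw, by
        rw [← sub_add_sub_cancel _ x w]
        refine (IsUltrametricDist.norm_add_le_max _ _).trans (max_le ?_ hxw)
        rwa [norm_sub_rev]⟩
    refine ⟨p, hp, z, hz, ?_⟩
    rw [← sub_add_sub_cancel _ (restrictTo (J : Set ι) x) z]
    exact (IsUltrametricDist.norm_add_le_max _ _).trans (max_le hxJ hz')
  have hle : ∀ p ∈ c, supportedOn k p.1 ≤ supportedOn k (⋃ p ∈ c, p.1) := fun p hp =>
    supportedOn_mono (Set.subset_biUnion_of_mem (u := fun p : Set ι × Set C₀(ι, k) => p.1) hp)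
  refine ⟨fun n x hx hw => ?_, ⟨fun b hb => ?_, fun s hs a b hb => ?_⟩, fun b hb => ?_,
    fun w hw => mem_closedSpan_iff.2 fun ε hε => ?_⟩
  · obtain ⟨p, hp, w, hw, hxw⟩ := key n x hx hw
    exact ⟨w, ⟨hw.1, hle p hp hw.2⟩, hxw⟩
  · obtain ⟨p, hp, hbp⟩ := Set.mem_iUnion₂.1 hb
    exact (hc p hp).orthonormal.norm_eq_one b hbp
  · obtain ⟨p, hp, hsp⟩ := DirectedOn.exists_mem_subset_of_finset_subset_biUnion hne
      (hchain.directedOn.mono fun {p q} h => h.2) hs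
    exact (hc p hp).orthonormal.norm_coeff_le s hsp a b hb
  · obtain ⟨p, hp, hbp⟩ := Set.mem_iUnion₂.1 hb
    exact ⟨((hc p hp).subset hbp).1, hle p hp ((hc p hp).subset hbp).2⟩
  · obtain ⟨n, hn⟩ := exists_nat_one_div_lt hε
    obtain ⟨p, hp, z, hz, hwz⟩ := key n w hw.2 ⟨w, hw.1, by
      rw [sub_self, norm_zero]
      exact Nat.one_div_pos_of_nat.le⟩
    obtain ⟨z', hz', hzz'⟩ := mem_closedSpan_iff.1 ((hc p hp).le_closedSpan hz) ε hε
    refine ⟨z', Submodule.span_mono (Set.subset_biUnion_of_mem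
      (u := fun p : Set ι × Set C₀(ι, k) => p.2) hp) hz', ?_⟩
    rw [← sub_add_sub_cancel w z z']
    exact (IsUltrametricDist.norm_add_le_max _ _).trans_lt (max_lt (hwz.trans_lt hn) hzz')

/-- **Gruson's theorem**: every subspace of `C₀(ι, k)` contains an orthonormal set with the same
closed span. -/
theorem exists_isOrthonormalSet_le_closedSpan (W : Submodule k C₀(ι, k)) :
    ∃ B : Set C₀(ι, k), IsOrthonormalSet k B ∧ B ⊆ W ∧ W ≤ closedSpan k B := by
  obtain ⟨⟨A, B⟩, hAB, hmax⟩ := zorn_le₀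
    {p : Set ι × Set C₀(ι, k) | IsPartialBasis W p.1 p.2} fun c hc hchain => by
      rcases c.eq_empty_or_nonempty with rfl | hne
      · exact ⟨(∅, ∅), isPartialBasis_empty W, by simp⟩
      · exact ⟨(⋃ p ∈ c, p.1, ⋃ p ∈ c, p.2), isPartialBasis_biUnion hc hne hchain,
          fun p hp => ⟨Set.subset_biUnion_of_mem (u := fun p : Set ι × Set C₀(ι, k) => p.1) hp,
            Set.subset_biUnion_of_mem (u := fun p : Set ι × Set C₀(ι, k) => p.2) hp⟩⟩
  refine ⟨B, hAB.orthonormal, fun b hb => (hAB.subset hb).1, fun w hw =>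
    hAB.le_closedSpan ⟨hw, fun i hi => absurd ?_ hi⟩⟩
  obtain ⟨A', B', hA, hi, hB, h'⟩ := hAB.exists_extension i
  exact (hmax (y := (A', B')) h' ⟨hA, hB⟩).1 hi

end Subspaces

/-- A complete space that embeds isometrically into a free space is free. -/
theorem IsFree.of_linearIsometry {k : Type u} [NormedField k] [IsUltrametricDist k]
    [CompleteSpace k] {V : Type v} [NormedAddCommGroup V] [NormedSpace k V] [IsUltrametricDist V]
    [CompleteSpace V] {Y : Type w} [NormedAddCommGroup Y] [NormedSpace k Y]
    [IsUltrametricDist Y] [CompleteSpace Y] (h : IsFree k V) (φ : Y →ₗᵢ[k] V) : IsFree k Y := by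
  obtain ⟨ι, _, _, ⟨ψ⟩⟩ := h.exists_linearIsometry
  let χ : Y →ₗᵢ[k] C₀(ι, k) := ψ.comp φ
  obtain ⟨B, hB, hBW, hWB⟩ := exists_isOrthonormalSet_le_closedSpan (LinearMap.range χ.toLinearMap)
  have himage : χ '' (χ ⁻¹' B) = B := Set.image_preimage_eq_of_subset hBW
  refine ⟨χ ⁻¹' B, (IsOrthonormalSet.of_image χ (by rwa [himage])).isOrthonormalSchauderBasis
    (eq_top_iff.2 fun y _ => mem_closedSpan_iff.2 fun ε hε => ?_)⟩
  obtain ⟨w, hw, hlt⟩ := mem_closedSpan_iff.1 (hWB ⟨y, rfl⟩) ε hε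
  have hmap : Submodule.span k B = (Submodule.span k (χ ⁻¹' B)).map χ.toLinearMap := by
    rw [Submodule.map_span]
    exact congrArg _ himage.symm
  rw [hmap] at hw
  obtain ⟨z, hz, rfl⟩ := hw
  refine ⟨z, hz, ?_⟩
  rw [← χ.norm_map, map_sub]
  exact hlt

/-! ### Families of subspaces indexed by ordinals -/

section Ordinals

variable {κ : Cardinal.{v}}

theorem exists_forall_lt_of_isRegular (hκ : κ.IsRegular) {α : Type v} (hα : #α < κ)
    (f : α → Set.Iio κ.ord) : ∃ b : Set.Iio κ.ord, ∀ a, f a < b := by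
  have h : (⨆ a, (f a : Ordinal.{v}) + 1) < κ.ord :=
    Ordinal.iSup_add_one_lt_of_lt_cof (by rwa [hκ.cof_ord]) fun a => (f a).2
  exact ⟨⟨_, h⟩, fun a => Ordinal.lt_iSup_add_one (fun a => (f a : Ordinal.{v})) a⟩

theorem exists_isLUB_of_bddAbove {d : Set (Set.Iio κ.ord)} (hd : BddAbove d) :
    ∃ a, IsLUB d a := by
  obtain ⟨a, ha, hmin⟩ := wellFounded_lt.has_min (upperBounds d) hd
  exact ⟨a, ha, fun b hb => not_lt.1 (hmin b hb)⟩

theorem isSuccLimit_of_isLUB {d : Set (Set.Iio κ.ord)} (hd : d.Nonempty) {a : Set.Iio κ.ord}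
    (ha : IsLUB d a) (had : a ∉ d) : Order.IsSuccLimit (a : Ordinal.{v}) := by
  have hlt : ∀ b ∈ d, b < a := fun b hb => (ha.1 hb).lt_of_ne fun h => had (h ▸ hb)
  obtain ⟨c, hc⟩ := hd
  refine ⟨fun hmin => ?_, fun b hb => ?_⟩
  · exact not_lt.2 (hmin (hlt c hc).le) (hlt c hc)
  · obtain ⟨c, hc, hbc⟩ := (lt_isLUB_iff ha (b := ⟨b, hb.1.trans a.2⟩)).1 hb.1
    exact hb.2 hbc (hlt c hc)

/-- A type of cardinality `κ` is the union of an increasing sequence, of length the initial ordinal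
of `κ`, of subsets of smaller cardinality. -/
theorem exists_ordinal_rank {α : Type v} (hα : #α = κ) :
    ∃ ρ : α → Set.Iio κ.ord, ∀ b, #{a | ρ a < b} < κ := by
  have h : #α = #κ.ord.ToType := by rw [Cardinal.mk_toType, Cardinal.card_ord, hα]
  obtain ⟨e⟩ := Cardinal.eq.1 h
  refine ⟨fun a => Ordinal.ToType.mk.symm (e a), fun b => ?_⟩
  have hb : (b : Ordinal.{v}).card < κ := Cardinal.lt_ord.1 b.2
  refine lt_of_le_of_lt ?_ hb
  rw [← Cardinal.lift_le.{v + 1}, ← Cardinal.mk_Iio_ordinal]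
  refine Cardinal.mk_le_of_injective (f := fun a : ULift.{v + 1} _ =>
    ⟨(Ordinal.ToType.mk.symm (e a.down.1) : Set.Iio κ.ord).1, a.down.2⟩) fun a a' haa => ?_
  have := congrArg Subtype.val haa
  exact ULift.ext _ _ (Subtype.ext (e.injective (Ordinal.ToType.mk.symm.injective
    (Subtype.ext this))))

end Ordinals

section Families

variable {k : Type u} [NormedField k] {V : Type v} [NormedAddCommGroup V] [NormedSpace k V]
  {κ : Cardinal.{v}}

/-- An increasing family of subspaces that is continuous at limit ordinals. -/
structure IsContinuousFamily (F : Set.Iio κ.ord → Submodule k V) : Prop where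
  monotone : Monotone F
  limit : ∀ a : Set.Iio κ.ord, Order.IsSuccLimit (a : Ordinal.{v}) →
    F a ≤ closedSpan k (⋃ b : Set.Iio a, (F b : Set V))

theorem IsFreeFiltration.isContinuousFamily {F : Set.Iio (rank k V).ord → Submodule k V}
    (hF : IsFreeFiltration k V F) : IsContinuousFamily F where
  monotone a b hab := by
    rcases hab.eq_or_lt with rfl | hab
    · exact le_rfl
    · exact hF.mono b a hab
  limit a ha := (hF.limit a ha).le

theorem isContinuousFamily_closedSpan (E : Set V) (ρ : V → Set.Iio κ.ord) :
    IsContinuousFamily fun a => closedSpan k {e | e ∈ E ∧ ρ e < a} where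
  monotone _ _ hab := closedSpan_mono fun _ he => ⟨he.1, he.2.trans_le hab⟩
  limit a ha := closedSpan_mono fun e he => by
    have hlt : Order.succ (ρ e : Ordinal.{v}) < a := ha.succ_lt he.2
    exact Set.mem_iUnion.2 ⟨⟨⟨_, hlt.trans a.2⟩, hlt⟩,
      subset_closedSpan _ ⟨he.1, Order.lt_succ (ρ e : Ordinal.{v})⟩⟩

theorem IsContinuousFamily.le_of_isLUB {F : Set.Iio κ.ord → Submodule k V}
    (hF : IsContinuousFamily F) {d : Set (Set.Iio κ.ord)} (hd : d.Nonempty) {a : Set.Iio κ.ord}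
    (ha : IsLUB d a) {W : Submodule k V} (hW : IsClosed (W : Set V)) (h : ∀ b ∈ d, F b ≤ W) :
    F a ≤ W := by
  by_cases had : a ∈ d
  · exact h a had
  · refine (hF.limit a (isSuccLimit_of_isLUB hd ha had)).trans
      (closedSpan_le hW (Set.iUnion_subset fun b => ?_))
    obtain ⟨c, hc, hbc⟩ := (lt_isLUB_iff ha).1 b.2
    exact (hF.monotone hbc.le).trans (h c hc)

/-- Two continuous families of closed subspaces that are cofinal in each other agree on a
closed unbounded set. -/
theorem isClub_setOf_eq (hκ : κ.IsRegular) (hunc : ℵ₀ < κ) {F G : Set.Iio κ.ord → Submodule k V}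
    (hF : IsContinuousFamily F) (hG : IsContinuousFamily G)
    (hFc : ∀ a, IsClosed (F a : Set V)) (hGc : ∀ a, IsClosed (G a : Set V))
    (hFG : ∀ a, ∃ b, F a ≤ G b) (hGF : ∀ a, ∃ b, G a ≤ F b) : IsClub {a | F a = G a} := by
  refine ⟨fun d hd hne _ a ha => le_antisymm ?_ ?_, fun a => ?_⟩
  · exact hF.le_of_isLUB hne ha (hGc a) fun b hb =>
      (hd hb : F b = G b).le.trans (hG.monotone (ha.1 hb))
  · exact hG.le_of_isLUB hne ha (hFc a) fun b hb =>
      (hd hb : F b = G b).ge.trans (hF.monotone (ha.1 hb))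
  · have hstep : ∀ a, ∃ b, F a ≤ G b ∧ G a ≤ F b := fun a => by
      obtain ⟨b, hb⟩ := hFG a
      obtain ⟨b', hb'⟩ := hGF a
      exact ⟨max b b', hb.trans (hG.monotone (le_max_left _ _)),
        hb'.trans (hF.monotone (le_max_right _ _))⟩
    choose s hs using hstep
    let x : ℕ → Set.Iio κ.ord := fun n => s^[n] a
    have hx : ∀ n, x (n + 1) = s (x n) := fun n => Function.iterate_succ_apply' _ _ _
    obtain ⟨b, hb⟩ := exists_forall_lt_of_isRegular hκ (α := ULift ℕ) (by simpa using hunc)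
      fun n => x n.down
    obtain ⟨c, hc⟩ := exists_isLUB_of_bddAbove (d := Set.range x)
      ⟨b, by rintro _ ⟨n, rfl⟩; exact (hb ⟨n⟩).le⟩
    refine ⟨c, le_antisymm ?_ ?_, hc.1 ⟨0, rfl⟩⟩
    · refine hF.le_of_isLUB (Set.range_nonempty x) hc (hGc c) ?_
      rintro _ ⟨n, rfl⟩
      exact (hs (x n)).1.trans (hG.monotone (hc.1 ⟨n + 1, hx n⟩))
    · refine hG.le_of_isLUB (Set.range_nonempty x) hc (hFc c) ?_
      rintro _ ⟨n, rfl⟩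
      exact (hs (x n)).2.trans (hF.monotone (hc.1 ⟨n + 1, hx n⟩))

theorem exists_closedSpan_le_of_mk_lt (hκ : κ.IsRegular) {F : Set.Iio κ.ord → Submodule k V}
    (hF : Monotone F) (hFc : ∀ a, IsClosed (F a : Set V)) (hcover : ∀ v, ∃ a, v ∈ F a)
    {S : Set V} (hS : #S < κ) : ∃ a, closedSpan k S ≤ F a := by
  choose f hf using hcover
  obtain ⟨a, ha⟩ := exists_forall_lt_of_isRegular hκ hS fun v => f v
  exact ⟨a, closedSpan_le (hFc a) fun v hv => hF (ha ⟨v, hv⟩).le (hf v)⟩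

theorem isClosed_of_mem_smallSubspaces {W : Submodule k V} (hW : W ∈ smallSubspaces k V κ) :
    IsClosed (W : Set V) := by
  obtain ⟨S, -, rfl⟩ := hW
  exact isClosed_closedSpan S

end Families

section Summands

variable {k : Type u} [NormedField k] {V : Type v} [NormedAddCommGroup V] [NormedSpace k V]

theorem IsFree.exists_isOrthonormalSet_range {Y : Type w} [NormedAddCommGroup Y] [NormedSpace k Y]
    (h : IsFree k Y) (φ : Y →ₗᵢ[k] V) :
    ∃ B : Set V, IsOrthonormalSet k B ∧ B ⊆ LinearMap.range φ.toLinearMap ∧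
      LinearMap.range φ.toLinearMap ≤ closedSpan k B := by
  obtain ⟨B, hB⟩ := h
  refine ⟨φ '' B, hB.isOrthonormalSet.image φ, Set.image_subset_range _ _, ?_⟩
  rintro _ ⟨y, rfl⟩
  refine mem_closedSpan_iff.2 fun ε hε => ?_
  obtain ⟨z, hz, hyz⟩ := mem_closedSpan_iff.1 
    (hB.closedSpan_eq_top ▸ Submodule.mem_top : y ∈ closedSpan k B) ε hε
  refine ⟨φ z, ?_, ?_⟩
  · have : φ '' B = φ.toLinearMap '' B := rfl
    rw [this, ← Submodule.map_span]
    exact ⟨z, hz, rfl⟩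
  · change ‖φ y - φ z‖ < ε
    rwa [← map_sub, φ.norm_map]

variable [IsUltrametricDist V]

theorem IsOrthonormalSchauderBasis.exists_add_eq {E : Set V}
    (hE : IsOrthonormalSchauderBasis k E) (P : V → Prop) (v : V) :
    ∃ x ∈ closedSpan k {e | e ∈ E ∧ P e}, ∃ y ∈ closedSpan k {e | e ∈ E ∧ ¬ P e}, x + y = v := by
  classical
  obtain ⟨c, hc, hv⟩ := hE.expansion v
  have key : ∀ Q : V → Prop, ∃ x ∈ closedSpan k {e | e ∈ E ∧ Q e},
      HasSum (fun e : E => (if Q e then c e else 0) • (e : V)) x := by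
    intro Q
    obtain ⟨x, hx, -⟩ := hE.norm_sum (fun e => if Q e then c e else 0) (by
      refine squeeze_zero_norm (fun e => ?_) (tendsto_zero_iff_norm_tendsto_zero.1 hc)
      split_ifs <;> simp)
    refine ⟨x, (isClosed_closedSpan _).mem_of_tendsto hx (Eventually.of_forall fun s =>
      Submodule.sum_mem _ fun e _ => ?_), hx⟩
    split_ifs with hQ
    · exact Submodule.smul_mem _ _ (subset_closedSpan _ ⟨e.2, hQ⟩)
    · simp
  obtain ⟨x, hx, hx'⟩ := key P
  obtain ⟨y, hy, hy'⟩ := key fun e => ¬ P e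
  refine ⟨x, hx, y, hy, (hx'.add hy').unique ?_⟩
  convert hv using 2 with e
  by_cases he : P e <;> simp [he]

theorem IsOrthonormalSet.norm_le_norm_add {B B' : Set V} (h : IsOrthonormalSet k (B ∪ B'))
    (hd : Disjoint B B') {x y : V} (hx : x ∈ closedSpan k B) (hy : y ∈ closedSpan k B') :
    ‖y‖ ≤ ‖x + y‖ := by
  classical
  have key : ∀ x ∈ Submodule.span k B, ∀ y ∈ Submodule.span k B', ‖y‖ ≤ ‖x + y‖ := by
    intro x hx y hy
    obtain ⟨a, s, hs, -, rfl⟩ := Submodule.mem_span_iff_exists_finset_subset.1 hx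
    obtain ⟨c, t, ht, -, rfl⟩ := Submodule.mem_span_iff_exists_finset_subset.1 hy
    have hst : Disjoint s t := Finset.disjoint_left.2 fun b hbs hbt =>
      Set.disjoint_left.1 hd (hs hbs) (ht hbt)
    have hsum : ∑ b ∈ s, a b • b + ∑ b ∈ t, c b • b =
        ∑ b ∈ s ∪ t, (if b ∈ t then c b else a b) • b := by
      rw [Finset.sum_union hst]
      refine congrArg₂ (· + ·) (Finset.sum_congr rfl fun b hb => ?_)
        (Finset.sum_congr rfl fun b hb => by rw [if_pos hb])
      rw [if_neg (Finset.disjoint_left.1 hst hb)]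
    refine IsUltrametricDist.norm_sum_le_of_forall_le_of_nonneg (norm_nonneg _) fun b hb => ?_
    rw [norm_smul, h.norm_eq_one b (Or.inr (ht hb)), mul_one, hsum]
    have := h.norm_coeff_le (s ∪ t) (by
      rw [Finset.coe_union]
      exact Set.union_subset_union hs ht) (fun b => if b ∈ t then c b else a b) b
      (Finset.mem_union_right _ hb)
    simpa only [if_pos hb] using this
  by_contra! hlt
  have hpos : 0 < ‖y‖ := (norm_nonneg _).trans_lt hlt
  obtain ⟨x', hx', hxx⟩ := mem_closedSpan_iff.1 hx _ hpos
  obtain ⟨y', hy', hyy⟩ := mem_closedSpan_iff.1 hy _ hpos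
  have h1 : ‖y‖ ≤ ‖y'‖ := by
    have : ‖y‖ ≤ max ‖y - y'‖ ‖y'‖ := by
      simpa using IsUltrametricDist.norm_add_le_max (y - y') y'
    exact (le_max_iff.1 this).resolve_left (not_le.2 hyy)
  have h2 : ‖x' + y'‖ < ‖y‖ := by
    have : x' + y' = (x + y) + (-(x - x') + -(y - y')) := by abel
    rw [this]
    refine (IsUltrametricDist.norm_add_le_max _ _).trans_lt (max_lt hlt ?_)
    refine (IsUltrametricDist.norm_add_le_max _ _).trans_lt (max_lt ?_ ?_) <;> rwa [norm_neg]
  exact absurd (h1.trans (key x' hx' y' hy')) (not_le.2 h2)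

variable [IsUltrametricDist k] [CompleteSpace k] [CompleteSpace V]

theorem IsFree.of_isClosed (h : IsFree k V) {W : Submodule k V} (hW : IsClosed (W : Set V)) :
    IsFree k W :=
  have : CompleteSpace W := hW.completeSpace_coe
  h.of_linearIsometry W.subtypeₗᵢ

theorem IsOrthonormalSchauderBasis.isCofreeSummand {E : Set V}
    (hE : IsOrthonormalSchauderBasis k E) (P : V → Prop) {U : Submodule k V}
    (hU : IsClosed (U : Set V)) (hle : closedSpan k {e | e ∈ E ∧ P e} ≤ U) :
    IsCofreeSummand ((closedSpan k {e | e ∈ E ∧ P e}).submoduleOf U) := by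
  set X := closedSpan k {e | e ∈ E ∧ P e} with hX
  set Y := closedSpan k {e | e ∈ E ∧ ¬ P e} with hY
  have hnorm : ∀ x ∈ X, ∀ y ∈ Y, ‖x + y‖ = max ‖x‖ ‖y‖ := fun x hx y hy =>
    norm_add_eq_max_of_norm_le ((hE.isOrthonormalSet.mono (Set.union_subset
      (fun e he => he.1) fun e he => he.1)).norm_le_norm_add
      (Set.disjoint_left.2 fun e he he' => he'.2 he.2) hx hy)
  have hcl : IsClosed ((Y.submoduleOf U : Submodule k U) : Set U) :=
    (isClosed_closedSpan _).preimage continuous_subtype_val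
  have : CompleteSpace U := hU.completeSpace_coe
  have : CompleteSpace (Y.submoduleOf U) := hcl.completeSpace_coe
  have hadd : ∀ x : X.submoduleOf U × Y.submoduleOf U, ‖(x.1 : U) + (x.2 : U)‖ = ‖x‖ :=
    fun x => hnorm _ x.1.2 _ x.2.2
  refine ⟨Y.submoduleOf U, hcl, IsFree.of_linearIsometry ⟨E, hE⟩
    (U.subtypeₗᵢ.comp (Y.submoduleOf U).subtypeₗᵢ), ⟨fun x x' hxx => ?_, fun v => ?_⟩, hadd⟩
  · have h0 := hadd (x - x')
    have : ((x - x').1 : U) + ((x - x').2 : U) = 0 := by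
      have : (x.1 : U) + (x.2 : U) = (x'.1 : U) + (x'.2 : U) := hxx
      rw [Prod.fst_sub, Prod.snd_sub, Submodule.coe_sub, Submodule.coe_sub, sub_add_sub_comm,
        this, sub_self]
    rw [this, norm_zero] at h0
    exact sub_eq_zero.1 (norm_eq_zero.1 h0.symm)
  · obtain ⟨x, hx, y, hy, hxy⟩ := hE.exists_add_eq P v
    have hyU : y ∈ U := by
      rw [← add_sub_cancel_left x y, hxy]
      exact U.sub_mem v.2 (hle hx)
    exact ⟨(⟨⟨x, hle hx⟩, hx⟩, ⟨⟨y, hyU⟩, hy⟩), Subtype.ext hxy⟩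

end Summands

/-! ### The equivalence -/

section Implications

variable {k : Type u} [NormedField k] {V : Type v} [NormedAddCommGroup V] [NormedSpace k V]

theorem IsAlmostFree.exists_isFreeFiltration (h : IsAlmostFree k V) (hcard : #V = rank k V)
    (hreg : (rank k V).IsRegular) : ∃ F : Set.Iio (rank k V).ord → Submodule k V,
      IsFreeFiltration k V F := by
  obtain ⟨ρ, hρ⟩ := exists_ordinal_rank hcard
  let F : Set.Iio (rank k V).ord → Submodule k V := fun a =>
    closedSpan k {e | e ∈ Set.univ ∧ ρ e < a}
  have hF : IsContinuousFamily F := isContinuousFamily_closedSpan Set.univ ρ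
  have hsmall : ∀ a, F a ∈ smallSubspaces k V (rank k V) := fun a =>
    ⟨_, by simpa using hρ a, rfl⟩
  refine ⟨F, hsmall, fun a => h _ (hsmall a), fun a b hab => hF.monotone hab.le,
    fun a ha => le_antisymm (hF.limit a ha) ?_, Set.eq_univ_of_forall fun v => ?_⟩
  · exact closedSpan_le (isClosed_closedSpan _) (Set.iUnion_subset fun b => hF.monotone b.2.le)
  · obtain ⟨a, ha⟩ := exists_forall_lt_of_isRegular hreg (α := PUnit)
      (by simpa using Cardinal.one_lt_aleph0.trans_le hreg.aleph0_le) fun _ => ρ v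
    exact Set.mem_iUnion.2 ⟨a, subset_closedSpan _ ⟨trivial, ha ⟨⟩⟩⟩

variable [CompleteSpace k] [IsUltrametricDist V] [CompleteSpace V]

/-- If the stages in a club set are almost cofree summands, each of them has a free complement in
the next one. The bases of these complements form a basis of the whole space, once the first of them
is replaced by a basis of the second stage in the club set. -/
theorem IsFreeFiltration.isFree {F : Set.Iio (rank k V).ord → Submodule k V}
    (hF : IsFreeFiltration k V F) (hreg : (rank k V).IsRegular)
    (h : ¬ IsStationary (exceptionalSet F)) : IsFree k V := by
  obtain ⟨C, hC, hdisj⟩ := not_isStationary_iff.1 h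
  have hmono := hF.isContinuousFamily.monotone
  have hFc := fun a => isClosed_of_mem_smallSubspaces (hF.mem_smallSubspaces a)
  have hcofree : ∀ a ∈ C, IsAlmostCofreeSummand (F a) := fun a ha =>
    not_not.1 fun hn => Set.disjoint_left.1 hdisj hn ha
  have hnext : ∀ a, ∃ b ∈ C, a < b ∧ ∀ c ∈ C, a < c → b ≤ c := fun a => by
    obtain ⟨b, hb⟩ := exists_forall_lt_of_isRegular hreg (α := PUnit)
      (by simpa using Cardinal.one_lt_aleph0.trans_le hreg.aleph0_le) fun _ => a
    obtain ⟨c, hc, hbc⟩ := hC.isCofinal b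
    obtain ⟨m, hm, hmin⟩ := wellFounded_lt.has_min {c | c ∈ C ∧ a < c}
      ⟨c, hc, (hb ⟨⟩).trans_le hbc⟩
    exact ⟨m, hm.1, hm.2, fun c hc hac => not_lt.1 (hmin c ⟨hc, hac⟩)⟩
  choose next hnextC hlt hnext using hnext
  -- the least element of `C` has no predecessor in `C`: there the whole next stage is taken
  have hblock : ∀ a : C, ∃ B : Set V, IsOrthonormalSet k B ∧ B ⊆ F (next a) ∧
      ∃ D : Submodule k V, F (next a) ≤ closedSpan k (D ∪ B) ∧
        (∀ d ∈ D, ∀ w ∈ Submodule.span k B, ‖w‖ ≤ ‖d + w‖) ∧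
        ((∀ b : C, a ≤ b) ∧ D = ⊥ ∨ (∃ b : C, b < a) ∧ D = F a) := by
    intro a
    by_cases hmin : ∃ b : C, b < a
    · have hle : F a ≤ F (next a) := hmono (hlt a).le
      obtain ⟨W, -, hW, hbij, hnorm⟩ := hcofree a a.2 _ (hF.mem_smallSubspaces (next a)) hle
      obtain ⟨B, hB, hBW, hWB⟩ := hW.exists_isOrthonormalSet_range
        ((F (next a)).subtypeₗᵢ.comp W.subtypeₗᵢ)
      refine ⟨B, hB, fun b hb => ?_, F a, fun v hv => ?_, fun d hd w hw => ?_, Or.inr ⟨hmin, rfl⟩⟩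
      · obtain ⟨x, rfl⟩ := hBW hb
        exact (x : F (next a)).2
      · obtain ⟨⟨x, y⟩, hxy⟩ := hbij.2 ⟨v, hv⟩
        have hv' : ((x : F (next a)) : V) + ((y : F (next a)) : V) = v := congrArg Subtype.val hxy
        rw [← hv']
        exact Submodule.add_mem _ (subset_closedSpan _ (Or.inl x.2))
          (closedSpan_mono Set.subset_union_right (hWB ⟨y, rfl⟩))
      · obtain ⟨y, rfl⟩ := Submodule.span_le.2 hBW hw
        have := hnorm (⟨⟨d, hle hd⟩, hd⟩, y)
        exact (le_max_right _ _).trans this.ge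
    · obtain ⟨B, hB, hBW, hWB⟩ := (hF.free (next a)).exists_isOrthonormalSet_range
        (F (next a)).subtypeₗᵢ
      refine ⟨B, hB, fun b hb => ?_, ⊥, fun v hv => ?_, fun d hd w hw => ?_, Or.inl ⟨?_, rfl⟩⟩
      · obtain ⟨x, rfl⟩ := hBW hb
        exact x.2
      · exact closedSpan_mono Set.subset_union_right (hWB ⟨⟨v, hv⟩, rfl⟩)
      · rw [(Submodule.mem_bot k).1 hd, zero_add]
      · exact fun b => not_lt.1 fun hb => hmin ⟨b, hb⟩
  choose B hB hBF D hDB hDnorm hD using hblock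
  have hnextle : ∀ a b : C, a < b → next a ≤ b := fun a b hab => hnext a b b.2 hab
  have hspan : ∀ a : C, F (next a) ≤ closedSpan k (⋃ a, B a) := by
    intro a
    induction a using WellFoundedLT.induction with
    | ind a ih =>
      refine (hDB a).trans (closedSpan_le (isClosed_closedSpan _) (Set.union_subset ?_
        ((Set.subset_iUnion B a).trans (subset_closedSpan _))))
      rcases hD a with ⟨-, hDa⟩ | ⟨⟨b, hb⟩, hDa⟩
      · rw [hDa]
        exact bot_le (a := closedSpan k (⋃ a, B a))
      · rw [hDa]
        -- `a` is the supremum of the successors in `C` of its predecessors in `C`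
        set d : Set (Set.Iio (rank k V).ord) := {c | ∃ b : C, b < a ∧ next b = c} with hd
        have hda : (a : Set.Iio (rank k V).ord) ∈ upperBounds d := by
          rintro _ ⟨c, hc, rfl⟩
          exact hnextle c a hc
        have hdne : d.Nonempty := ⟨_, b, hb, rfl⟩
        obtain ⟨c, hc⟩ := exists_isLUB_of_bddAbove ⟨_, hda⟩
        have hcC : c ∈ C := hC.isLUB_mem (by rintro _ ⟨b, -, rfl⟩; exact hnextC b) hdne hc
        have hca : c = a := (hc.2 hda).eq_of_not_lt fun hlt' =>
          absurd (hc.1 ⟨⟨c, hcC⟩, hlt', rfl⟩) (not_le.2 (hlt c))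
        refine hF.isContinuousFamily.le_of_isLUB hdne (hca ▸ hc) (isClosed_closedSpan _) ?_
        rintro _ ⟨b, hb, rfl⟩
        exact ih b hb
  refine ⟨⋃ a, B a, (isOrthonormalSet_iUnion hB fun a d hd w hw => hDnorm a d ?_ w hw)
    |>.isOrthonormalSchauderBasis (eq_top_iff.2 fun v _ => ?_)⟩
  · rcases hD a with ⟨hmin, hDa⟩ | ⟨-, hDa⟩
    · have : (⋃ b : Set.Iio a, B b) = ∅ :=
        Set.iUnion_eq_empty.2 fun b => absurd b.2 (not_lt.2 (hmin b))
      rwa [hDa, ← Submodule.span_empty (R := k), ← this]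
    · rw [hDa]
      exact Submodule.span_le.2 (Set.iUnion_subset fun b : Set.Iio a =>
        (hBF b).trans (hmono (hnextle b a b.2))) hd
  · obtain ⟨a, ha⟩ := Set.mem_iUnion.1 (hF.exhaust ▸ Set.mem_univ v : v ∈ ⋃ a, (F a : Set V))
    obtain ⟨b, hb, hab⟩ := hC.isCofinal a
    exact hspan ⟨b, hb⟩ (hmono (hab.trans (hlt b).le) ha)

variable [IsUltrametricDist k]

theorem IsFree.isAlmostFree (h : IsFree k V) : IsAlmostFree k V := fun _ hW =>
  h.of_isClosed (isClosed_of_mem_smallSubspaces hW)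

/-- A filtration of a free space agrees on a club set with the filtration given by an enumeration
of a basis, and the latter consists of almost cofree summands. -/
theorem IsFree.not_isStationary_exceptionalSet (h : IsFree k V) (hcard : #V = rank k V)
    (hreg : (rank k V).IsRegular) (hunc : ℵ₀ < rank k V)
    {F : Set.Iio (rank k V).ord → Submodule k V} (hF : IsFreeFiltration k V F) :
    ¬ IsStationary (exceptionalSet F) := by
  obtain ⟨E, hE⟩ := h
  obtain ⟨ρ, hρ⟩ := exists_ordinal_rank hcard
  let G : Set.Iio (rank k V).ord → Submodule k V := fun a => closedSpan k {e | e ∈ E ∧ ρ e < a}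
  have hG : IsContinuousFamily G := isContinuousFamily_closedSpan E ρ
  have hGcover : ∀ v, ∃ a, v ∈ G a := fun v => by
    obtain ⟨c, hc, hv⟩ := hE.expansion v
    have hcount : {e : E | c e ≠ 0}.Countable := by
      have := hc.countable_compl_preimage_ker
      simpa [Set.compl_def, Set.preimage] using this
    obtain ⟨a, ha⟩ := exists_forall_lt_of_isRegular hreg
      ((Cardinal.le_aleph0_iff_set_countable.2 hcount).trans_lt hunc) fun e => ρ (e : E)
    refine ⟨a, (isClosed_closedSpan _).mem_of_tendsto hv (Eventually.of_forall fun s =>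
      Submodule.sum_mem _ fun e _ => ?_)⟩
    by_cases he : c e = 0
    · simp [he]
    · exact Submodule.smul_mem _ _ (subset_closedSpan _ ⟨e.2, ha ⟨e, he⟩⟩)
  have hFcover : ∀ v, ∃ a, v ∈ F a := fun v => by
    simpa using (hF.exhaust ▸ Set.mem_univ v : v ∈ ⋃ a, (F a : Set V))
  have hFc := fun a => isClosed_of_mem_smallSubspaces (hF.mem_smallSubspaces a)
  refine not_isStationary_iff.2 ⟨{a | F a = G a}, ?_, Set.disjoint_left.2 fun a ha haG => ha ?_⟩
  · refine isClub_setOf_eq hreg hunc hF.isContinuousFamily hG hFc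
      (fun a => isClosed_closedSpan _) (fun a => ?_) fun a => ?_
    · obtain ⟨S, hS, hSF⟩ := hF.mem_smallSubspaces a
      rw [← hSF]
      exact exists_closedSpan_le_of_mk_lt hreg hG.monotone (fun a => isClosed_closedSpan _)
        hGcover hS
    · exact exists_closedSpan_le_of_mk_lt hreg hF.isContinuousFamily.monotone hFc hFcover
        ((Cardinal.mk_le_mk_of_subset fun e he => he.2).trans_lt (hρ a))
  · intro U hU hle
    rw [(haG : F a = G a)] at hle ⊢
    exact hE.isCofreeSummand _ (isClosed_of_mem_smallSubspaces hU) hle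

end Implications

end NonArchBanach

theorem mainTheorem4 {k : Type*} [NormedField k] [IsUltrametricDist k] [CompleteSpace k]
    {V : Type*} [NormedAddCommGroup V] [NormedSpace k V] [IsUltrametricDist V] [CompleteSpace V]
    (hcard : #V = NonArchBanach.rank k V)
    (hreg : (NonArchBanach.rank k V).IsRegular)
    (hunc : ℵ₀ < NonArchBanach.rank k V) :
    List.TFAE [
      NonArchBanach.IsFree k V,
      ∃ F : Set.Iio (NonArchBanach.rank k V).ord → Submodule k V,
        NonArchBanach.IsFreeFiltration k V F ∧
          ¬ IsStationary (NonArchBanach.exceptionalSet F),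
      NonArchBanach.IsAlmostFree k V ∧
        ∀ F : Set.Iio (NonArchBanach.rank k V).ord → Submodule k V,
          NonArchBanach.IsFreeFiltration k V F →
            ¬ IsStationary (NonArchBanach.exceptionalSet F)] := by
  tfae_have 1 → 3 := fun h => ⟨h.isAlmostFree, fun F hF =>
    h.not_isStationary_exceptionalSet hcard hreg hunc hF⟩
  tfae_have 3 → 2 := fun ⟨h, h'⟩ =>
    let ⟨F, hF⟩ := h.exists_isFreeFiltration hcard hreg
    ⟨F, hF, h' F hF⟩
  tfae_have 2 → 1 := fun ⟨_, hF, h⟩ => hF.isFree hreg h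
  tfae_finish
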